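/- Let $\tau\in[0,1)$. For a sequence $(p_k)_{k\ge 0}$ of real polynomials with $\deg p_k=k$ and for $p\in\mathbb{Z}_{\ge 0}$, let $(A^p)^j_k$ ($j,k\in\mathbb{Z}_{\ge0}$) denote the coefficients of the expansion $$z^p\,p_k(z)=\sum_{j\ge 0}(A^p)^j_k\,p_j(z).$$ Write $\mathcal I_p=\{-p,-p+2,\dots,p-2,p\}$, let $(x)_n=x(x+1)\cdots(x+n-1)$ be the Pochhammer symbol, and use the convention that $\frac1{n!}=0$ for integers $n<0$ (a term containing such a factor is $0$) and $\binom{k}{m}=0$ unless $0\le m\le k$. Let $H_k$, $L_k^\nu$, $C_k^{(c)}$ denote the (physicists') Hermite, generalised Laguerre and Gegenbauer polynomials, in the standard normalisations $$H_k(x)=(-1)^k e^{x^2}\tfrac{d^k}{dx^k}e^{-x^2},\qquad L_k^\nu(x)=\tfrac{x^{-\nu}e^x}{k!}\tfrac{d^k}{dx^k}\big(x^{k+\nu}e^{-x}\big),$$ $$C_k^{(c)}(x)=\tfrac{(-1)^k}{2^k k!}\tfrac{\Gamma(c+\frac12)\Gamma(k+2c)}{\Gamma(2c)\Gamma(c+k+\frac12)}(1-x^2)^{-c+\frac12}\tfrac{d^k}{dx^k}\big[(1-x^2)^{k+c-\frac12}\big].$$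 For $\tau=0$ the polynomials $p_k$ below are understood as their limits as $\tau\downarrow0$, that is, $p_k(z)=z^k$. (i) For the planar Hermite polynomials $p_k(z)=(\tau/2)^{k/2}H_k\big(z/\sqrt{2\tau}\big)$, $$(A^p)^j_k=\tau^{\frac{p+k-j}{2}}\sum_{l=0}^{\lfloor p/2\rfloor}\frac{p!}{2^l\,l!\,\big(\frac{p-k+j}{2}-l\big)!}\binom{k}{\frac{p+k-j}{2}-l}$$ if $j-k\in\mathcal I_p$, and $(A^p)^j_k=0$ otherwise. (ii) Let $\nu>-1$. For the planar Laguerre polynomials $p_k(z)=(-1)^k k!\,\tau^k L_k^\nu(z/\tau)$, $$(A^p)^j_k=\tau^{p+k-j}\sum_{l=0}^{p}\frac{p!}{(p-l)!}\frac{\Gamma(p+\nu+1)}{\Gamma(l+\nu+1)}\frac{k!}{\Gamma(j+\nu+1)}\sum_{s\ge0}\frac{\Gamma(s+\nu+1)\,2^{j+k+l-2s}}{(s-j)!\,(s-k)!\,(s-l)!\,(j+k+l-2s)!}$$ if $|j-k|\le p$, and $(A^p)^j_k=0$ otherwise. (Only finitely many terms of the sum over $s$ are nonzero.) (iii) Let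 $a>-1$. For the planar Gegenbauer polynomials $p_k(z)=\frac{k!}{(1+a)_k}\big(\frac{\sqrt\tau}{2}\big)^k C_k^{(1+a)}\big(z/\sqrt\tau\big)$, $$\begin{aligned}(A^p)^j_k=\tau^{\frac{p+k-j}{2}}\sum_{l=0}^{\lfloor p/2\rfloor}&\frac{k!\,2^j(1+a)_j}{2^k(1+a)_k}\,\frac{p!}{2^p}\,\frac{p-2l+a+1}{l!\,(a+1)_{p+1-l}}\,\frac{j+a+1}{\frac{p-2l+k+j}{2}+a+1}\\&\times\frac{(a+1)_{\frac{k+p-2l-j}{2}}\,(a+1)_{\frac{j+p-2l-k}{2}}\,(a+1)_{\frac{j+k-p+2l}{2}}\,(2a+2)_{\frac{j+k+p-2l}{2}}}{\big(\frac{k+p-2l-j}{2}\big)!\,\big(\frac{j+p-2l-k}{2}\big)!\,\big(\frac{j+k-p+2l}{2}\big)!\,(a+1)_{\frac{j+k+p-2l}{2}}\,(2a+2)_j}\end{aligned}$$ if $j-k\in\mathcal I_p$, and $(A^p)^j_k=0$ otherwise. Throughout, $0^0=1$. -/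

import Mathlib

open Polynomial
open scoped Nat

noncomputable section

/-! ### Classical orthogonal polynomials -/

/-- The Pochhammer symbol `(x)_n = x (x + 1) ⋯ (x + n - 1)`. -/
def poch (x : ℝ) (n : ℕ) : ℝ := (ascPochhammer ℝ n).eval x

/-- The (physicists') Hermite polynomial `H_k`; see `hermiteH_rodrigues`. -/
def hermiteH (k : ℕ) : ℝ[X] :=
  ∑ m ∈ Finset.range (k / 2 + 1),
    C ((-1 : ℝ) ^ m * k ! / (m ! * (k - 2 * m)!) * 2 ^ (k - 2 * m)) * X ^ (k - 2 * m)

/-- The generalised Laguerre polynomial `L_k^ν`; see `laguerreL_rodrigues`. -/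
def laguerreL (ν : ℝ) (k : ℕ) : ℝ[X] :=
  ∑ i ∈ Finset.range (k + 1),
    C ((-1 : ℝ) ^ i * poch (ν + i + 1) (k - i) / ((k - i)! * i !)) * X ^ i

/-- The Gegenbauer polynomial `C_n^{(c)}`; see `gegenbauerC_rodrigues`. -/
def gegenbauerC (c : ℝ) (n : ℕ) : ℝ[X] :=
  ∑ m ∈ Finset.range (n / 2 + 1),
    C ((-1 : ℝ) ^ m * poch c (n - m) / (m ! * (n - 2 * m)!) * 2 ^ (n - 2 * m)) * X ^ (n - 2 * m)

lemma poch_zero (x : ℝ) : poch x 0 = 1 := by simp [poch]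

lemma poch_succ (x : ℝ) (n : ℕ) : poch x (n + 1) = poch x n * (x + n) := by
  simp [poch, ascPochhammer_succ_eval]

lemma poch_succ_left (x : ℝ) (n : ℕ) : poch x (n + 1) = x * poch (x + 1) n := by
  simp [poch, ascPochhammer_succ_left]

lemma poch_pos {x : ℝ} (hx : 0 < x) (n : ℕ) : 0 < poch x n := ascPochhammer_pos n x hx

/-- Coefficients of a sum of monomials in steps of two. -/
lemma coeff_step_two (f : ℕ → ℝ) (k m : ℕ) (h : 2 * m ≤ k) :
    (∑ m ∈ Finset.range (k / 2 + 1), C (f m) * X ^ (k - 2 * m) : ℝ[X]).coeff (k - 2 * m) = f m := by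
  simp only [finsetSum_coeff, coeff_C_mul, coeff_X_pow]
  rw [Finset.sum_eq_single m]
  · simp
  · intro b hb hbm
    have : b ≤ k / 2 := by simpa [Nat.lt_succ_iff] using hb
    have : k - 2 * m ≠ k - 2 * b := by omega
    simp [this]
  · intro hm
    exact absurd (Finset.mem_range.2 (by omega)) hm

lemma coeff_step_two_zero (f : ℕ → ℝ) (k n : ℕ) (h : ∀ m, n + 2 * m ≠ k) :
    (∑ m ∈ Finset.range (k / 2 + 1), C (f m) * X ^ (k - 2 * m) : ℝ[X]).coeff n = 0 := by
  simp only [finsetSum_coeff, coeff_C_mul, coeff_X_pow]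
  refine Finset.sum_eq_zero fun b hb => ?_
  have hb' : b ≤ k / 2 := by simpa [Nat.lt_succ_iff] using hb
  have : n ≠ k - 2 * b := fun hn => h b (by omega)
  simp [this]

lemma hermiteH_coeff (n m : ℕ) :
    (hermiteH (n + 2 * m)).coeff n = (-1) ^ m * (n + 2 * m)! / (m ! * n !) * 2 ^ n := by
  have := coeff_step_two (fun i => (-1) ^ i * ((n + 2 * m)! : ℝ) / (i ! * (n + 2 * m - 2 * i)!)
    * 2 ^ (n + 2 * m - 2 * i)) (n + 2 * m) m (by omega)
  simpa [hermiteH] using this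

lemma hermiteH_coeff_zero (k n : ℕ) (h : ∀ m, n + 2 * m ≠ k) : (hermiteH k).coeff n = 0 :=
  coeff_step_two_zero _ k n h

lemma gegenbauerC_coeff (c : ℝ) (n m : ℕ) :
    (gegenbauerC c (n + 2 * m)).coeff n
      = (-1) ^ m * poch c (n + m) / (m ! * n !) * 2 ^ n := by
  have := coeff_step_two (fun i => (-1) ^ i * poch c (n + 2 * m - i) / (i ! * (n + 2 * m - 2 * i)!)
    * 2 ^ (n + 2 * m - 2 * i)) (n + 2 * m) m (by omega)
  simpa [gegenbauerC, show n + 2 * m - m = n + m by omega] using this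

lemma gegenbauerC_coeff_zero (c : ℝ) (k n : ℕ) (h : ∀ m, n + 2 * m ≠ k) :
    (gegenbauerC c k).coeff n = 0 :=
  coeff_step_two_zero _ k n h

lemma laguerreL_coeff (ν : ℝ) (i d : ℕ) :
    (laguerreL ν (i + d)).coeff i = (-1) ^ i * poch (ν + i + 1) d / (d ! * i !) := by
  simp only [laguerreL, finsetSum_coeff, coeff_C_mul, coeff_X_pow]
  rw [Finset.sum_eq_single i]
  · simp
  · intro b _ hb
    simp [hb.symm]
  · intro h
    exact absurd (Finset.mem_range.2 (by omega)) h

lemma laguerreL_coeff_zero (ν : ℝ) (k i : ℕ) (h : k < i) : (laguerreL ν k).coeff i = 0 := by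
  simp only [laguerreL, finsetSum_coeff, coeff_C_mul, coeff_X_pow]
  refine Finset.sum_eq_zero fun b hb => ?_
  have : i ≠ b := by have := Finset.mem_range.1 hb; omega
  simp [this]

/-! ### Rodrigues formulas -/

lemma hermiteH_succ (k : ℕ) :
    hermiteH (k + 1) = C 2 * (X * hermiteH k) - derivative (hermiteH k) := by
  ext n
  rw [coeff_sub, coeff_C_mul, coeff_derivative]
  by_cases hn : ∃ m, n + 2 * m = k + 1
  · obtain ⟨m, hm⟩ := hn
    rw [← hm, hermiteH_coeff, hm]
    rcases n with _ | n
    · obtain ⟨m, rfl⟩ : ∃ m', m = m' + 1 := ⟨m - 1, by omega⟩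
      obtain rfl : k = 1 + 2 * m := by omega
      rw [coeff_X_mul_zero, hermiteH_coeff]
      push_cast [Nat.factorial_succ, pow_succ]
      field_simp
      ring_nf
    · obtain rfl : k = n + 2 * m := by omega
      rw [coeff_X_mul, hermiteH_coeff]
      rcases m with _ | m
      · rw [hermiteH_coeff_zero _ _ (by omega)]
        push_cast [Nat.factorial_succ, pow_succ]
        field_simp
        ring_nf
      · have := hermiteH_coeff (n + 1 + 1) m
        rw [show n + 1 + 1 + 2 * m = n + 2 * (m + 1) by omega] at this
        rw [this]
        push_cast [Nat.factorial_succ, pow_succ]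
        field_simp
        ring_nf
  · push Not at hn
    rw [hermiteH_coeff_zero _ _ hn, hermiteH_coeff_zero k (n + 1) (fun m h => hn (m + 1) (by omega))]
    rcases n with _ | n
    · simp
    · rw [coeff_X_mul, hermiteH_coeff_zero k n (fun m h => hn m (by omega))]
      simp

/-- `H_k(x) = (-1)^k e^{x²} (d/dx)^k e^{-x²}`. -/
theorem hermiteH_rodrigues (k : ℕ) (x : ℝ) :
    (hermiteH k).eval x
      = (-1) ^ k * Real.exp (x ^ 2) * iteratedDeriv k (fun t : ℝ => Real.exp (-t ^ 2)) x := by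
  suffices h : iteratedDeriv k (fun t : ℝ => Real.exp (-t ^ 2))
      = fun t => (-1) ^ k * ((hermiteH k).eval t * Real.exp (-t ^ 2)) by
    have h1 : ((-1 : ℝ) ^ k) * (-1) ^ k = 1 := by rw [← mul_pow]; simp
    have h2 : Real.exp (x ^ 2) * Real.exp (-x ^ 2) = 1 := by rw [← Real.exp_add]; simp
    rw [h]
    linear_combination (-(hermiteH k).eval x) * h1
      - (hermiteH k).eval x * (-1) ^ k * (-1) ^ k * h2
  induction k with
  | zero => ext t; simp [hermiteH]
  | succ k ih =>
    rw [iteratedDeriv_succ, ih]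
    ext t
    have h1 : HasDerivAt (fun t : ℝ => Real.exp (-t ^ 2)) (Real.exp (-t ^ 2) * (-(2 * t))) t := by
      simpa using ((hasDerivAt_pow 2 t).neg).exp
    have h2 := (((hermiteH k).hasDerivAt t).mul h1).const_mul ((-1 : ℝ) ^ k)
    refine (HasDerivAt.deriv h2).trans ?_
    rw [hermiteH_succ]
    simp only [eval_sub, eval_mul, eval_C, eval_X]
    ring

lemma laguerreL_succ (ν : ℝ) (k : ℕ) :
    C ((k : ℝ) + 1) * laguerreL ν (k + 1)
      = C (ν + 1) * laguerreL (ν + 1) k - X * laguerreL (ν + 1) k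
        + X * derivative (laguerreL (ν + 1) k) := by
  ext i
  rw [coeff_add, coeff_sub, coeff_C_mul, coeff_C_mul]
  rcases i with _ | i
  · have h1 := laguerreL_coeff ν 0 (k + 1)
    have h2 := laguerreL_coeff (ν + 1) 0 k
    rw [zero_add] at h1 h2
    rw [coeff_X_mul_zero, coeff_X_mul_zero, h1, h2, poch_succ_left]
    push_cast [Nat.factorial_succ]
    field_simp
    ring_nf
  · rw [coeff_X_mul, coeff_X_mul, coeff_derivative]
    rcases lt_trichotomy i k with h | h | h
    · obtain ⟨d, rfl⟩ : ∃ d, k = i + 1 + d := ⟨k - (i + 1), by omega⟩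
      have h1 := laguerreL_coeff ν (i + 1) (d + 1)
      have h2 := laguerreL_coeff (ν + 1) (i + 1) d
      have h3 := laguerreL_coeff (ν + 1) i (d + 1)
      rw [show i + (d + 1) = i + 1 + d by omega] at h3
      rw [← add_assoc] at h1
      rw [h1, h2, h3, show ν + 1 + (i : ℝ) + 1 = ν + ((i + 1 : ℕ) : ℝ) + 1 by push_cast; ring,
        poch_succ_left,
        show ν + 1 + ((i + 1 : ℕ) : ℝ) + 1 = ν + ((i + 1 : ℕ) : ℝ) + 1 + 1 by ring]
      push_cast [Nat.factorial_succ, pow_succ]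
      field_simp
      ring_nf
    · subst h
      have h1 := laguerreL_coeff ν (i + 1) 0
      have h3 := laguerreL_coeff (ν + 1) i 0
      rw [add_zero] at h1 h3
      rw [h1, h3, laguerreL_coeff_zero _ _ _ (Nat.lt_succ_self i), poch_zero, poch_zero]
      push_cast [Nat.factorial_succ, pow_succ]
      field_simp
      ring_nf
    · rw [laguerreL_coeff_zero _ _ _ (by omega), laguerreL_coeff_zero _ _ _ (by omega),
        laguerreL_coeff_zero _ _ _ h]
      simp

/-- `L_k^ν(x) = (x^{-ν} e^x / k!) (d/dx)^k (x^{k+ν} e^{-x})` for `x > 0`. -/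
theorem laguerreL_rodrigues (ν : ℝ) (k : ℕ) {x : ℝ} (hx : 0 < x) :
    (laguerreL ν k).eval x
      = x ^ (-ν) * Real.exp x / k !
        * iteratedDeriv k (fun t : ℝ => t ^ ((k : ℝ) + ν) * Real.exp (-t)) x := by
  suffices h : ∀ (ν : ℝ) (x : ℝ), 0 < x →
      iteratedDeriv k (fun t : ℝ => t ^ ((k : ℝ) + ν) * Real.exp (-t)) x
      = k ! * ((x ^ ν * Real.exp (-x)) * (laguerreL ν k).eval x) by
    have h1 : x ^ (-ν) * x ^ ν = 1 := by rw [← Real.rpow_add hx]; simp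
    have h2 : Real.exp x * Real.exp (-x) = 1 := by rw [← Real.exp_add]; simp
    have h3 : (k ! : ℝ) ≠ 0 := by positivity
    rw [h ν x hx]
    field_simp
    linear_combination (-(laguerreL ν k).eval x) * h1
      - (laguerreL ν k).eval x * x ^ (-ν) * x ^ ν * h2
  clear hx x ν
  induction k with
  | zero => intro ν x _; simp [laguerreL, poch_zero]
  | succ k ih =>
    intro ν x hx
    rw [iteratedDeriv_succ]
    have he : iteratedDeriv k (fun t : ℝ => t ^ (((k + 1 : ℕ) : ℝ) + ν) * Real.exp (-t))
        =ᶠ[nhds x] fun t => k ! * ((t ^ (ν + 1) * Real.exp (-t)) * (laguerreL (ν + 1) k).eval t) := by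
      filter_upwards [lt_mem_nhds hx] with t ht
      rw [← ih (ν + 1) t ht]
      rw [show ((k + 1 : ℕ) : ℝ) + ν = (k : ℝ) + (ν + 1) by push_cast; ring]
    rw [he.deriv_eq]
    have h1 : HasDerivAt (fun t : ℝ => t ^ (ν + 1)) ((ν + 1) * x ^ (ν + 1 - 1)) x :=
      Real.hasDerivAt_rpow_const (Or.inl hx.ne')
    have h2 : HasDerivAt (fun t : ℝ => Real.exp (-t)) (Real.exp (-x) * (-1)) x :=
      (hasDerivAt_neg x).exp
    have h3 := ((h1.mul h2).mul ((laguerreL (ν + 1) k).hasDerivAt x)).const_mul (k ! : ℝ)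
    refine (HasDerivAt.deriv h3).trans ?_
    have h4 := congrArg (eval x) (laguerreL_succ ν k)
    simp only [eval_add, eval_sub, eval_mul, eval_C, eval_X] at h4
    simp only [Pi.mul_apply]
    rw [add_sub_cancel_right, Real.rpow_add_one hx.ne']
    push_cast [Nat.factorial_succ]
    linear_combination (-(k ! : ℝ) * x ^ ν * Real.exp (-x)) * h4

lemma gegenbauerC_succ (c : ℝ) (hc : c ≠ 0) (n : ℕ) :
    C (-(((n : ℝ) + 1) * (n + 1 + 2 * c) / (2 * c))) * gegenbauerC c (n + 1)
      = C (-(2 * c + 1)) * (X * gegenbauerC (c + 1) n)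
        + (derivative (gegenbauerC (c + 1) n)
          - X * (X * derivative (gegenbauerC (c + 1) n))) := by
  ext i
  rw [coeff_add, coeff_sub, coeff_C_mul, coeff_C_mul, coeff_derivative]
  by_cases hi : ∃ m, i + 2 * m = n + 1
  · obtain ⟨m, hm⟩ := hi
    have h0 := gegenbauerC_coeff c i m
    rw [hm] at h0
    rw [h0]
    rcases i with _ | i
    · obtain ⟨m, rfl⟩ : ∃ m', m = m' + 1 := ⟨m - 1, by omega⟩
      obtain rfl : n = 1 + 2 * m := by omega
      rw [coeff_X_mul_zero, coeff_X_mul_zero, gegenbauerC_coeff, zero_add, poch_succ_left,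
        Nat.add_comm 1 m, poch_succ]
      push_cast [Nat.factorial_succ, pow_succ]
      field_simp
      ring_nf
    · obtain rfl : n = i + 2 * m := by omega
      have h1 : (X * derivative (gegenbauerC (c + 1) (i + 2 * m))).coeff i
          = i * (gegenbauerC (c + 1) (i + 2 * m)).coeff i := by
        rcases i with _ | i
        · simp
        · rw [coeff_X_mul, coeff_derivative]
          push_cast
          ring
      rw [coeff_X_mul, coeff_X_mul, h1, gegenbauerC_coeff,
        show i + 1 + m = (i + m) + 1 by omega, poch_succ_left]
      rcases m with _ | m
      · rw [gegenbauerC_coeff_zero _ _ _ (by omega)]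
        push_cast [Nat.factorial_succ, pow_succ]
        field_simp
        ring_nf
      · have h2 := gegenbauerC_coeff (c + 1) (i + 1 + 1) m
        rw [show i + 1 + 1 + 2 * m = i + 2 * (m + 1) by omega,
          show i + 1 + 1 + m = (i + (m + 1)) + 1 by omega, poch_succ] at h2
        rw [h2]
        push_cast [Nat.factorial_succ, pow_succ]
        field_simp
        ring_nf
  · push Not at hi
    rw [gegenbauerC_coeff_zero _ _ _ hi,
      gegenbauerC_coeff_zero _ n (i + 1) (fun m h => hi (m + 1) (by omega))]
    rcases i with _ | i
    · simp
    · have h3 := gegenbauerC_coeff_zero (c + 1) n i (fun m h => hi m (by omega))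
      rw [coeff_X_mul, coeff_X_mul, h3]
      rcases i with _ | i
      · simp
      · rw [coeff_X_mul, coeff_derivative, h3]
        simp

/-- Rodrigues' formula for `C_n^{(c)}(x)`, for `c > 0` and `-1 < x < 1`. -/
theorem gegenbauerC_rodrigues (c : ℝ) (hc : 0 < c) (n : ℕ) {x : ℝ} (hx : |x| < 1) :
    (gegenbauerC c n).eval x
      = (-1) ^ n / (2 ^ n * n !)
        * (Real.Gamma (c + 1 / 2) * Real.Gamma (n + 2 * c)
            / (Real.Gamma (2 * c) * Real.Gamma (c + n + 1 / 2)))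
        * (1 - x ^ 2) ^ (-c + 1 / 2)
        * iteratedDeriv n (fun t : ℝ => (1 - t ^ 2) ^ ((n : ℝ) + c - 1 / 2)) x := by
  have hpos : ∀ {t : ℝ}, |t| < 1 → 0 < 1 - t ^ 2 := by
    intro t ht
    have := (sq_lt_one_iff_abs_lt_one t).2 ht
    linarith
  have hG : ∀ (y : ℝ), 0 < y → ∀ m : ℕ, Real.Gamma (y + m) = poch y m * Real.Gamma y := by
    intro y hy m
    induction m with
    | zero => simp [poch_zero]
    | succ m ih =>
      push_cast
      rw [← add_assoc, Real.Gamma_add_one (by positivity), ih, poch_succ]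
      ring
  suffices h : ∀ (c : ℝ), 0 < c → ∀ x : ℝ, |x| < 1 →
      iteratedDeriv n (fun t : ℝ => (1 - t ^ 2) ^ ((n : ℝ) + c - 1 / 2)) x
      = (-1) ^ n * 2 ^ n * n ! * poch (c + 1 / 2) n / poch (2 * c) n
        * ((1 - x ^ 2) ^ (c - 1 / 2) * (gegenbauerC c n).eval x) by
    have h1 : (1 - x ^ 2) ^ (-c + 1 / 2) * (1 - x ^ 2) ^ (c - 1 / 2) = 1 := by
      rw [← Real.rpow_add (hpos hx)]; simp
    have h2 : ((-1 : ℝ) ^ n) * (-1) ^ n = 1 := by rw [← mul_pow]; simp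
    have g1 := hG (c + 1 / 2) (by positivity) n
    have g2 := hG (2 * c) (by positivity) n
    have p1 := poch_pos (show 0 < c + 1 / 2 by positivity) n
    have p2 := poch_pos (show 0 < 2 * c by positivity) n
    have q1 := Real.Gamma_pos_of_pos (show 0 < c + 1 / 2 by positivity)
    have q2 := Real.Gamma_pos_of_pos (show 0 < 2 * c by positivity)
    rw [h c hc x hx, show (n : ℝ) + 2 * c = 2 * c + n by ring,
      show c + (n : ℝ) + 1 / 2 = c + 1 / 2 + n by ring, g1, g2]
    generalize Real.Gamma (c + 1 / 2) = G1 at *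
    generalize Real.Gamma (2 * c) = G2 at *
    generalize poch (c + 1 / 2) n = P1 at *
    generalize poch (2 * c) n = P2 at *
    generalize (1 - x ^ 2) ^ (-c + 1 / 2) = U at *
    generalize (1 - x ^ 2) ^ (c - 1 / 2) = V at *
    field_simp
    linear_combination (-(gegenbauerC c n).eval x) * h1
      - (gegenbauerC c n).eval x * U * V * h2
  clear hx x hc c hG
  induction n with
  | zero => intro c _ x _; simp [gegenbauerC, poch_zero]
  | succ n ih =>
    intro c hc x hx
    rw [iteratedDeriv_succ]
    have he : iteratedDeriv n (fun t : ℝ => (1 - t ^ 2) ^ (((n + 1 : ℕ) : ℝ) + c - 1 / 2))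
        =ᶠ[nhds x] fun t => (-1) ^ n * 2 ^ n * n ! * poch (c + 1 + 1 / 2) n / poch (2 * (c + 1)) n
          * ((1 - t ^ 2) ^ (c + 1 - 1 / 2) * (gegenbauerC (c + 1) n).eval t) := by
      have hU : {t : ℝ | |t| < 1} ∈ nhds x :=
        (isOpen_lt continuous_abs continuous_const).mem_nhds hx
      filter_upwards [hU] with t ht
      rw [← ih (c + 1) (by positivity) t ht]
      rw [show ((n + 1 : ℕ) : ℝ) + c - 1 / 2 = (n : ℝ) + (c + 1) - 1 / 2 by push_cast; ring]
    rw [he.deriv_eq]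
    have h0 : HasDerivAt (fun t : ℝ => 1 - t ^ 2) (-(2 * x)) x := by
      simpa using (hasDerivAt_pow 2 x).const_sub 1
    have h1 : HasDerivAt (fun t : ℝ => (1 - t ^ 2) ^ (c + 1 - 1 / 2))
        (-(2 * x) * (c + 1 - 1 / 2) * (1 - x ^ 2) ^ (c + 1 - 1 / 2 - 1)) x :=
      h0.rpow_const (Or.inl (hpos hx).ne')
    have h3 := (h1.mul ((gegenbauerC (c + 1) n).hasDerivAt x)).const_mul
      ((-1) ^ n * 2 ^ n * n ! * poch (c + 1 + 1 / 2) n / poch (2 * (c + 1)) n)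
    refine (HasDerivAt.deriv h3).trans ?_
    have h4 := congrArg (eval x) (gegenbauerC_succ c hc.ne' n)
    simp only [eval_add, eval_sub, eval_mul, eval_C, eval_X] at h4
    have e1 : (1 - x ^ 2) ^ (c + 1 - 1 / 2) = (1 - x ^ 2) ^ (c - 1 / 2) * (1 - x ^ 2) := by
      rw [← Real.rpow_add_one (hpos hx).ne']; ring_nf
    have p2 := poch_pos (show 0 < 2 * (c + 1) by positivity) n
    have e3 : poch (2 * c) (n + 1)
        = 2 * c * (2 * c + 1) * poch (2 * (c + 1)) n / (2 * c + n + 1) := by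
      have := poch_succ (2 * c) (n + 1)
      rw [poch_succ_left, poch_succ_left] at this
      rw [eq_div_iff (by positivity), show 2 * (c + 1) = 2 * c + 1 + 1 by ring]
      push_cast at this
      linear_combination -this
    rw [e1, show c + 1 - 1 / 2 - 1 = c - 1 / 2 by ring, e3, poch_succ_left (c + 1 / 2),
      show c + 1 / 2 + 1 = c + 1 + 1 / 2 by ring]
    generalize poch (c + 1 + 1 / 2) n = P1 at *
    generalize poch (2 * (c + 1)) n = P2 at *
    generalize (1 - x ^ 2) ^ (c - 1 / 2) = V at *
    generalize eval x (gegenbauerC c (n + 1)) = G at *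
    generalize eval x (gegenbauerC (c + 1) n) = F at *
    generalize eval x (derivative (gegenbauerC (c + 1) n)) = D at *
    have h5 : -(2 * x) * (c + 1 - 1 / 2) * V * F + V * (1 - x ^ 2) * D
        = V * (-(((n : ℝ) + 1) * (n + 1 + 2 * c) / (2 * c)) * G) := by
      rw [h4]; ring
    rw [h5]
    have : 2 * c + (n : ℝ) + 1 ≠ 0 := by positivity
    push_cast [Nat.factorial_succ, pow_succ]
    field_simp
    ring

/-! ### Planar orthogonal polynomials

For `τ = 0` the closed forms below are read as their limits for `τ ↓ 0`, which are the
monomials `z^k`. -/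

/-- `p_k^H(z) = (τ/2)^{k/2} H_k(z / √(2τ))`. -/
def planarHermite (τ : ℝ) (k : ℕ) : ℝ[X] :=
  if τ = 0 then X ^ k
  else C ((τ / 2) ^ ((k : ℝ) / 2)) * (hermiteH k).comp (C (1 / √(2 * τ)) * X)

/-- `p_k^L(z) = (-1)^k k! τ^k L_k^ν(z / τ)`. -/
def planarLaguerre (τ ν : ℝ) (k : ℕ) : ℝ[X] :=
  if τ = 0 then X ^ k
  else C ((-1) ^ k * k ! * τ ^ k) * (laguerreL ν k).comp (C (1 / τ) * X)

/-- `p_k^G(z) = (k! / (1+a)_k) (√τ / 2)^k C_k^{(1+a)}(z / √τ)`. -/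
def planarGegenbauer (τ a : ℝ) (k : ℕ) : ℝ[X] :=
  if τ = 0 then X ^ k
  else C (k ! / poch (1 + a) k * (√τ / 2) ^ k) * (gegenbauerC (1 + a) k).comp (C (1 / √τ) * X)

lemma degree_rescale {P : ℝ[X]} {k : ℕ} (h0 : ∀ i, k < i → P.coeff i = 0) (h1 : P.coeff k ≠ 0)
    {u v : ℝ} (hu : u ≠ 0) (hv : v ≠ 0) : (C u * P.comp (C v * X)).degree = k := by
  have hP : P.natDegree = k :=
    le_antisymm (natDegree_le_iff_coeff_eq_zero.2 h0) (le_natDegree_of_ne_zero h1)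
  have hP0 : P ≠ 0 := fun h => h1 (by simp [h])
  rw [degree_C_mul hu]
  have hq : (C v * X : ℝ[X]).natDegree = 1 := natDegree_C_mul_X v hv
  have hne : P.comp (C v * X) ≠ 0 := by
    rw [Ne, ← leadingCoeff_eq_zero, leadingCoeff_comp (by simp [hq])]
    simp [hP0, hv]
  rw [degree_eq_natDegree hne, natDegree_comp, hq, hP, mul_one]

/-- The planar Hermite polynomials as a sequence with `deg p_k = k`. -/
def planarHermiteSeq (τ : ℝ) (hτ : 0 ≤ τ) : Polynomial.Sequence ℝ where
  elems' := planarHermite τ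
  degree_eq' k := by
    rcases hτ.eq_or_lt with rfl | h
    · simp [planarHermite]
    · rw [planarHermite, if_neg h.ne']
      refine degree_rescale (fun i hi => hermiteH_coeff_zero _ _ (by omega)) ?_
        (by positivity) (by positivity)
      have := hermiteH_coeff k 0
      rw [mul_zero, add_zero] at this
      rw [this]
      positivity

/-- The planar Laguerre polynomials as a sequence with `deg p_k = k`. -/
def planarLaguerreSeq (τ ν : ℝ) : Polynomial.Sequence ℝ where
  elems' := planarLaguerre τ ν
  degree_eq' k := by
    rcases eq_or_ne τ 0 with rfl | h
    · simp [planarLaguerre]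
    · rw [planarLaguerre, if_neg h]
      refine degree_rescale (fun i hi => laguerreL_coeff_zero _ _ _ hi) ?_
        (by positivity) (by positivity)
      have := laguerreL_coeff ν k 0
      rw [add_zero, poch_zero] at this
      rw [this]
      positivity

/-- The planar Gegenbauer polynomials as a sequence with `deg p_k = k`. -/
def planarGegenbauerSeq (τ a : ℝ) (hτ : 0 ≤ τ) (ha : -1 < a) : Polynomial.Sequence ℝ where
  elems' := planarGegenbauer τ a
  degree_eq' k := by
    rcases hτ.eq_or_lt with rfl | h
    · simp [planarGegenbauer]
    · have hp := poch_pos (show 0 < 1 + a by linarith) k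
      rw [planarGegenbauer, if_neg h.ne']
      refine degree_rescale (fun i hi => gegenbauerC_coeff_zero _ _ _ (by omega)) ?_
        (by positivity) (by positivity)
      have := gegenbauerC_coeff (1 + a) k 0
      rw [mul_zero, add_zero] at this
      rw [this]
      positivity

/-! ### The expansion coefficients -/

/-- `(p_j)_{j ≥ 0}` as a basis of the space of polynomials. -/
def seqBasis (S : Polynomial.Sequence ℝ) : Module.Basis ℕ ℝ ℝ[X] :=
  S.basis fun i => isUnit_iff_ne_zero.2 (leadingCoeff_ne_zero.2 (S.ne_zero i))

/-- `(A^p)^j_k`: the coefficient of `p_j` in the expansion of `T_p p_k(z) = z^p p_k(z)`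
in the basis `(p_j)_{j ≥ 0}`. -/
def mulPowCoeff (S : Polynomial.Sequence ℝ) (p j k : ℕ) : ℝ :=
  (seqBasis S).repr (X ^ p * S k) j

/-- The expansion that defines the coefficients, evaluated at a complex number. -/
theorem mulPowCoeff_expansion (S : Polynomial.Sequence ℝ) (p k : ℕ) (z : ℂ) :
    z ^ p * aeval z (S k)
      = ∑ j ∈ ((seqBasis S).repr (X ^ p * S k)).support,
          (mulPowCoeff S p j k : ℂ) * aeval z (S j) := by
  have h := (seqBasis S).linearCombination_repr (X ^ p * S k)
  have h3 : z ^ p * aeval z (S k) = aeval z (X ^ p * S k) := by simp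
  rw [h3]
  conv_lhs => rw [← h, Finsupp.linearCombination_apply, Finsupp.sum, map_sum]
  refine Finset.sum_congr rfl fun j _ => ?_
  simp [mulPowCoeff, seqBasis]

/-- The index set `I_p = {-p, -p + 2, …, p - 2, p}`. -/
def stepRange (p : ℕ) : Set ℤ := {r | ∃ i : ℕ, i ≤ p ∧ r = -(p : ℤ) + 2 * i}

/-- The reciprocal factorial `1 / n!` of an integer, with the convention `1 / n! = 0` for `n < 0`. -/
def invFact (n : ℤ) : ℝ := if 0 ≤ n then 1 / (n.toNat ! : ℝ) else 0

/-- The binomial coefficient `k choose m` for an integer `m`; it is `0` unless `0 ≤ m ≤ k`. -/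
def intBinom (k : ℕ) (m : ℤ) : ℝ := if 0 ≤ m then (k.choose m.toNat : ℝ) else 0

/-- The Pochhammer symbol `(x)_n` for an integer `n ≥ 0`. For `n < 0` it only occurs
multiplied by `1 / n! = 0`, and is given the value `1`. -/
def intPoch (x : ℝ) (n : ℤ) : ℝ := poch x n.toNat

end

/-! Multiplication by z^p is split into two classical expansions: z^p = Σ_n a_n p_n, and the
linearization p_n p_k = Σ_j c_j p_j. Multiplying the first by p_k and inserting the second gives
(A^p)^j_k as a single sum over n (`mulPowCoeff_eq_sum`, and `mulPowCoeff_eq_sum_step_two` for the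
two families with parity). The index l of the stated formulas is n itself for Laguerre, and (p -
n)/2 for Hermite and Gegenbauer.

Neither orthogonality nor an integral is used. Each family is monic and satisfies a recurrence X p_k
= p_{k+1} + b_k p_k + c_k p_{k-1}, found by comparing coefficients. Multiplication by X is therefore
tridiagonal on coordinates (`coord_X_mul`), so a_n is determined by induction on p and c_j by
induction on the index of one factor (`coord_X_pow_eq`, `coord_mul_eq`). It remains to check that
the closed forms obey these recurrences. For Hermite and Gegenbauer this becomes a rational identity
after division by a common factor (`gegenbauer_contiguous` is the hardest case; the linearization
there is Dougall's formula). For Laguerre the linearization coefficient is itself a sum, and its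
recurrence follows by telescoping (`laguerreSum_contiguous`).

Two conventions keep the cases few. Indices are integers and 1/n! = 0 for n < 0, so most boundary
terms vanish by themselves. The coefficients of the monic polynomials are polynomial in τ, so τ = 0
obeys the same recurrences. -/

noncomputable section

/-! ### Coordinates with respect to a sequence satisfying a three-term recurrence -/

/-- The coefficient of `p_j` in the expansion of `Q`, which is `0` for `j < 0`. -/
def coord (S : Polynomial.Sequence ℝ) (Q : ℝ[X]) (j : ℤ) : ℝ :=
  if 0 ≤ j then (seqBasis S).repr Q j.toNat else 0

/-- `X p_k = p_{k+1} + b_k p_k + c_k p_{k-1}`, with `c_0 = 0`. -/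
def HasRecurrence (S : Polynomial.Sequence ℝ) (b c : ℤ → ℝ) : Prop :=
  c 0 = 0 ∧ ∀ k : ℕ, X * S k = S (k + 1) + C (b k) * S k + C (c k) * S (k - 1)

lemma coord_natCast (S : Polynomial.Sequence ℝ) (Q : ℝ[X]) (j : ℕ) :
    coord S Q j = (seqBasis S).repr Q j := by simp [coord]

lemma coord_add (S : Polynomial.Sequence ℝ) (Q R : ℝ[X]) (j : ℤ) :
    coord S (Q + R) j = coord S Q j + coord S R j := by
  unfold coord; split_ifs <;> simp

lemma coord_sub (S : Polynomial.Sequence ℝ) (Q R : ℝ[X]) (j : ℤ) :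
    coord S (Q - R) j = coord S Q j - coord S R j := by
  unfold coord; split_ifs <;> simp

lemma coord_C_mul (S : Polynomial.Sequence ℝ) (r : ℝ) (Q : ℝ[X]) (j : ℤ) :
    coord S (C r * Q) j = r * coord S Q j := by
  unfold coord; split_ifs <;> simp [C_mul']

lemma coord_sum {ι : Type*} (S : Polynomial.Sequence ℝ) (s : Finset ι) (Q : ι → ℝ[X]) (j : ℤ) :
    coord S (∑ i ∈ s, Q i) j = ∑ i ∈ s, coord S (Q i) j := by
  unfold coord; split_ifs <;> simp [Finsupp.finsetSum_apply]

lemma coord_elem (S : Polynomial.Sequence ℝ) (k : ℕ) (j : ℤ) :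
    coord S (S k) j = if j = k then 1 else 0 := by
  have h : (seqBasis S).repr (S k) = Finsupp.single k 1 := by
    have := (seqBasis S).repr_self k
    simpa [seqBasis] using this
  unfold coord
  rw [h, Finsupp.single_apply]
  split_ifs <;> first | rfl | omega

/-- This is the transpose of the recurrence: p_j is reached from p_{j-1}, p_j and p_{j+1}. Both
sides are linear in Q and the p_k span, so Q = p_k suffices. The condition c 0 = 0 makes the
identity hold for every integer j. -/
lemma coord_X_mul {S : Polynomial.Sequence ℝ} {b c : ℤ → ℝ} (h : HasRecurrence S b c)
    (Q : ℝ[X]) (j : ℤ) :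
    coord S (X * Q) j
      = coord S Q (j - 1) + b j * coord S Q j + c (j + 1) * coord S Q (j + 1) := by
  have hQ : Q ∈ Submodule.span ℝ (Set.range S) := by
    rw [S.span fun i => isUnit_iff_ne_zero.2 (leadingCoeff_ne_zero.2 (S.ne_zero i))]
    trivial
  induction hQ using Submodule.span_induction with
  | mem x hx =>
    obtain ⟨k, rfl⟩ := hx
    rw [h.2, coord_add, coord_add, coord_C_mul, coord_C_mul]
    simp only [coord_elem]
    rcases k with _ | k
    · have hc := h.1
      push_cast
      split_ifs <;> first | omega | (subst_vars; simp [hc])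
      -- The surviving case is j = -1, where p_0 would leak into index -1 were c 0 not zero.
      rw [show j + 1 = 0 by omega]
      simp [hc]
    · rw [Nat.add_sub_cancel]
      push_cast
      split_ifs <;> first | omega | (subst_vars; simp)
  | zero => simp [coord]
  | add x y _ _ hx hy =>
    rw [mul_add, coord_add, hx, hy]
    simp only [coord_add]
    ring
  | smul r x _ hx =>
    rw [← C_mul', mul_left_comm, coord_C_mul, hx]
    simp only [coord_C_mul]
    ring

/-! ### Uniqueness of solutions of the recurrences, and the factorization through z^p -/

/-- The coordinates of the monomials are determined by the three-term recurrence. -/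
lemma coord_X_pow_eq {S : Polynomial.Sequence ℝ} {b c : ℤ → ℝ} (h : HasRecurrence S b c)
    (h0 : S 0 = 1) (u : ℕ → ℤ → ℝ) (hu0 : ∀ j, u 0 j = if j = 0 then 1 else 0)
    (hu : ∀ p j, u (p + 1) j = u p (j - 1) + b j * u p j + c (j + 1) * u p (j + 1))
    (p : ℕ) (j : ℤ) : coord S (X ^ p) j = u p j := by
  induction p generalizing j with
  | zero => rw [pow_zero, ← h0, coord_elem, hu0]; rfl
  | succ p ih => rw [pow_succ', coord_X_mul h, ih, ih, ih, hu]

/-- The linearization coefficients are determined by the three-term recurrence. -/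
lemma coord_mul_eq {S : Polynomial.Sequence ℝ} {b c : ℤ → ℝ} (h : HasRecurrence S b c)
    (h0 : S 0 = 1) (k : ℕ) (v : ℕ → ℤ → ℝ) (hv0 : ∀ j, v 0 j = if j = k then 1 else 0)
    (hv : ∀ (m : ℕ) j, v (m + 1) j = v m (j - 1) + b j * v m j + c (j + 1) * v m (j + 1)
      - b m * v m j - c m * v (m - 1) j)
    (m : ℕ) (j : ℤ) : coord S (S m * S k) j = v m j := by
  induction m using Nat.strong_induction_on generalizing j with
  | _ m ih =>
    rcases m with _ | m
    · rw [h0, one_mul, coord_elem, hv0]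
    -- The recurrence solved for its leading term and multiplied by p_k.
    · have e : S (m + 1) * S k
          = X * (S m * S k) - C (b m) * (S m * S k) - C (c m) * (S (m - 1) * S k) := by
        linear_combination (-S k) * h.2 m
      rw [e, coord_sub, coord_sub, coord_C_mul, coord_C_mul, coord_X_mul h, hv]
      have e1 := ih m (by omega)
      have e2 := ih (m - 1) (by omega)
      rw [e1, e1, e1, e2]

/-- Expand z^p in the basis, multiply by p_k, and take coordinates termwise. -/
lemma mulPowCoeff_eq_sum (S : Polynomial.Sequence ℝ) (p j k : ℕ)
    (hp : ∀ n : ℕ, p < n → coord S (X ^ p) n = 0) :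
    mulPowCoeff S p j k
      = ∑ n ∈ Finset.range (p + 1), coord S (X ^ p) n * coord S (S n * S k) j := by
  have e : (X ^ p : ℝ[X]) = ∑ n ∈ Finset.range (p + 1), C (coord S (X ^ p) n) * S n := by
    have h := (seqBasis S).linearCombination_repr (X ^ p : ℝ[X])
    rw [Finsupp.linearCombination_apply, Finsupp.sum_of_support_subset (s := Finset.range (p + 1))]
      at h
    · conv_lhs => rw [← h]
      refine Finset.sum_congr rfl fun n _ => ?_
      rw [coord_natCast, C_mul']
      simp [seqBasis]
    · intro n hn
      by_contra hn'
      rw [Finset.mem_range] at hn'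
      have := hp n (by omega)
      rw [coord_natCast] at this
      exact (Finsupp.mem_support_iff.1 hn) this
    · simp
  rw [mulPowCoeff, ← coord_natCast]
  conv_lhs => rw [e]
  rw [Finset.sum_mul, coord_sum]
  refine Finset.sum_congr rfl fun n _ => ?_
  rw [mul_assoc, coord_C_mul]

/-- If only the indices `n ≡ p mod 2` contribute, the expansion runs in steps of two. -/
lemma mulPowCoeff_eq_sum_step_two (S : Polynomial.Sequence ℝ) (p j k : ℕ)
    (hp : ∀ n : ℕ, (∀ l, n + 2 * l ≠ p) → coord S (X ^ p) n = 0) :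
    mulPowCoeff S p j k
      = ∑ l ∈ Finset.range (p / 2 + 1),
          coord S (X ^ p) ((p - 2 * l : ℕ) : ℤ) * coord S (S (p - 2 * l) * S k) j := by
  rw [mulPowCoeff_eq_sum S p j k fun n hn => hp n (by omega)]
  symm
  refine Finset.sum_of_injOn (fun l => p - 2 * l) ?_ ?_ ?_ (fun _ _ => rfl)
  · intro l hl l' hl' hll
    simp at hl hl' hll
    omega
  · intro l hl
    simp
  · intro n hn hn'
    rw [hp n, zero_mul]
    intro l hl
    exact hn' ⟨l, by simp; omega, by simp; omega⟩

/-! ### Factors indexed by integers -/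

lemma invFact_of_neg {n : ℤ} (hn : n < 0) : invFact n = 0 := if_neg (by omega)

lemma invFact_natCast (n : ℕ) : invFact n = 1 / (n ! : ℝ) := by simp [invFact]

lemma invFact_zero : invFact 0 = 1 := by simp [invFact]

/-- Because 1/n! = 0 for n < 0, this holds for all integers, n = 0 included. The later recurrences
use it across the boundary without case distinctions. -/
lemma invFact_sub_one (n : ℤ) : invFact (n - 1) = n * invFact n := by
  rcases lt_trichotomy n 0 with h | h | h
  · rw [invFact_of_neg h, invFact_of_neg (by omega), mul_zero]
  · subst h; rw [invFact_of_neg (by omega)]; simp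
  · obtain ⟨m, rfl⟩ : ∃ m : ℕ, n = m + 1 := ⟨(n - 1).toNat, by omega⟩
    have := invFact_natCast (m + 1)
    push_cast at this
    rw [add_sub_cancel_right, invFact_natCast, this]
    push_cast [Nat.factorial_succ]
    field_simp

/-- `r ^ n (x)_n / n!`, which is `0` for `n < 0`. -/
def powPochFact (r x : ℝ) (n : ℤ) : ℝ := r ^ n.toNat * intPoch x n * invFact n

/-- `r ^ n / n!`, which is `0` for `n < 0`. -/
def powFact (r : ℝ) (n : ℤ) : ℝ := r ^ n.toNat * invFact n

lemma powFact_of_neg (r : ℝ) {n : ℤ} (hn : n < 0) : powFact r n = 0 := by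
  simp [powFact, invFact_of_neg hn]

lemma powFact_zero (r : ℝ) : powFact r 0 = 1 := by simp [powFact, invFact_zero]

/-- The truncated exponent does no harm: for n ≤ 0 both sides are 0. -/
lemma mul_powFact_sub_one (r : ℝ) (n : ℤ) : r * powFact r (n - 1) = n * powFact r n := by
  unfold powFact
  rw [invFact_sub_one]
  rcases le_or_gt n 0 with h | h
  · rcases h.eq_or_lt with rfl | h
    · simp
    · simp [invFact_of_neg h]
  · obtain ⟨m, rfl⟩ : ∃ m : ℕ, n = m + 1 := ⟨(n - 1).toNat, by omega⟩
    rw [show ((m : ℤ) + 1).toNat = m + 1 by omega, show ((m : ℤ) + 1 - 1).toNat = m by omega]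
    ring

lemma powPochFact_of_neg (r x : ℝ) {n : ℤ} (hn : n < 0) : powPochFact r x n = 0 := by
  simp [powPochFact, invFact_of_neg hn]

lemma powPochFact_zero (r x : ℝ) : powPochFact r x 0 = 1 := by
  simp [powPochFact, invFact_zero, intPoch, poch_zero]

lemma intPoch_natCast (x : ℝ) (n : ℕ) : intPoch x n = poch x n := by simp [intPoch]

lemma intPoch_add_one (x : ℝ) {n : ℤ} (hn : 0 ≤ n) : intPoch x (n + 1) = intPoch x n * (x + n) := by
  lift n to ℕ using hn
  have h := intPoch_natCast x (n + 1)
  push_cast at h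
  rw [h, intPoch_natCast, poch_succ, Int.cast_natCast]

lemma intPoch_pos {x : ℝ} (hx : 0 < x) (n : ℤ) : 0 < intPoch x n := poch_pos hx _

lemma mul_powPochFact (r x : ℝ) (n : ℤ) :
    n * powPochFact r x n = r * (n - 1 + x) * powPochFact r x (n - 1) := by
  unfold powPochFact
  rw [invFact_sub_one]
  rcases le_or_gt n 0 with h | h
  · rcases h.eq_or_lt with rfl | h
    · simp
    · simp [invFact_of_neg h]
  · obtain ⟨m, rfl⟩ : ∃ m : ℕ, n = m + 1 := ⟨(n - 1).toNat, by omega⟩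
    rw [intPoch_add_one _ (by omega), add_sub_cancel_right,
      show ((m : ℤ) + 1).toNat = m + 1 by omega, show (m : ℤ).toNat = m by omega]
    push_cast
    ring

/-! ### Three-term recurrences -/

lemma coeff_rescale (u v : ℝ) (P : ℝ[X]) (n : ℕ) :
    (C u * P.comp (C v * X)).coeff n = u * (P.coeff n * v ^ n) := by
  rw [coeff_C_mul, comp_C_mul_X_coeff]

/-- The square roots of the normalisation cancel, leaving a polynomial in τ. At τ = 0 only m = 0
survives, which is the monomial, so the separate definition for τ = 0 plays no role afterwards. -/
lemma planarHermite_coeff {τ : ℝ} (hτ : 0 ≤ τ) (n m : ℕ) :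
    (planarHermite τ (n + 2 * m)).coeff n
      = (-(τ / 2)) ^ m * ((n + 2 * m)! : ℝ) / (m ! * n !) := by
  rcases hτ.eq_or_lt with rfl | h
  · rw [planarHermite, if_pos rfl, coeff_X_pow]
    rcases m with _ | m
    · have : (n ! : ℝ) ≠ 0 := by positivity
      simp [this]
    · simp
  · rw [planarHermite, if_neg h.ne', coeff_rescale, hermiteH_coeff]
    have e : (τ / 2) ^ (((n + 2 * m : ℕ) : ℝ) / 2) = √(τ / 2) ^ n * (τ / 2) ^ m := by
      have h2 : (0 : ℝ) ≤ τ / 2 := by positivity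
      rw [Real.sqrt_eq_rpow, ← Real.rpow_natCast, ← Real.rpow_natCast, ← Real.rpow_mul h2,
        ← Real.rpow_add (by positivity)]
      push_cast
      ring_nf
    have e2 : √(τ / 2) * (2 * (1 / √(2 * τ))) = 1 := by
      have : √(2 * τ) = 2 * √(τ / 2) := by
        rw [show 2 * τ = 2 ^ 2 * (τ / 2) by ring, Real.sqrt_mul (by positivity),
          Real.sqrt_sq (by positivity)]
      have h3 : √(τ / 2) ≠ 0 := by positivity
      rw [this]
      field_simp
    have e3 : √(τ / 2) ^ n * 2 ^ n * (1 / √(2 * τ)) ^ n = 1 := by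
      rw [mul_assoc, ← mul_pow, ← mul_pow, e2, one_pow]
    rw [e, neg_pow (τ / 2)]
    linear_combination ((τ / 2) ^ m * (-1) ^ m * ((n + 2 * m)! : ℝ) / (m ! * n !)) * e3

lemma planarHermite_coeff_zero (τ : ℝ) (k n : ℕ) (h : ∀ m, n + 2 * m ≠ k) :
    (planarHermite τ k).coeff n = 0 := by
  unfold planarHermite
  split_ifs
  · rw [coeff_X_pow, if_neg fun hn => h 0 (by omega)]
  · rw [coeff_rescale, hermiteH_coeff_zero k n h]; simp

lemma planarGegenbauer_coeff {τ a : ℝ} (hτ : 0 ≤ τ) (ha : -1 < a) (n m : ℕ) :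
    (planarGegenbauer τ a (n + 2 * m)).coeff n
      = (-(τ / 4)) ^ m * ((n + 2 * m)! : ℝ) * poch (1 + a) (n + m)
        / (poch (1 + a) (n + 2 * m) * m ! * n !) := by
  have hp := poch_pos (show 0 < 1 + a by linarith)
  rcases hτ.eq_or_lt with rfl | h
  · rw [planarGegenbauer, if_pos rfl, coeff_X_pow]
    rcases m with _ | m
    · have : (n ! : ℝ) ≠ 0 := by positivity
      have := (hp n).ne'
      simp
      field_simp
    · simp
  · rw [planarGegenbauer, if_neg h.ne', coeff_rescale, gegenbauerC_coeff]
    have h3 : √τ ≠ 0 := by positivity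
    have e3 : (√τ / 2) ^ n * 2 ^ n * (1 / √τ) ^ n = 1 := by
      rw [mul_assoc, ← mul_pow, ← mul_pow]
      field_simp
      simp
    have e4 : (√τ / 2) ^ (n + 2 * m) = (√τ / 2) ^ n * (τ / 4) ^ m := by
      rw [pow_add, pow_mul, div_pow (√τ) 2 2, Real.sq_sqrt hτ]
      norm_num
    have := (hp (n + 2 * m)).ne'
    rw [e4, neg_pow (τ / 4)]
    linear_combination ((τ / 4) ^ m * (-1) ^ m * ((n + 2 * m)! : ℝ) * poch (1 + a) (n + m)
        / (poch (1 + a) (n + 2 * m) * m ! * n !)) * e3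

lemma planarGegenbauer_coeff_zero (τ a : ℝ) (k n : ℕ) (h : ∀ m, n + 2 * m ≠ k) :
    (planarGegenbauer τ a k).coeff n = 0 := by
  unfold planarGegenbauer
  split_ifs
  · rw [coeff_X_pow, if_neg fun hn => h 0 (by omega)]
  · rw [coeff_rescale, gegenbauerC_coeff_zero _ k n h]; simp

lemma planarLaguerre_coeff (τ ν : ℝ) (i d : ℕ) :
    (planarLaguerre τ ν (i + d)).coeff i
      = (-τ) ^ d * ((i + d)! : ℝ) * poch (ν + i + 1) d / (d ! * i !) := by
  rcases eq_or_ne τ 0 with rfl | h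
  · rw [planarLaguerre, if_pos rfl, coeff_X_pow]
    rcases d with _ | d
    · have : (i ! : ℝ) ≠ 0 := by positivity
      simp [this, poch_zero]
    · simp
  · rw [planarLaguerre, if_neg h, coeff_rescale, laguerreL_coeff]
    have e : τ ^ i * (1 / τ) ^ i = 1 := by rw [← mul_pow, mul_one_div_cancel h, one_pow]
    have e1 : (-1 : ℝ) ^ i * (-1) ^ i = 1 := by rw [← mul_pow]; simp
    rw [pow_add, pow_add, neg_pow]
    linear_combination ((-1) ^ d * τ ^ d * ((i + d)! : ℝ) * poch (ν + i + 1) d / (d ! * i !))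
      * (((-1) ^ i * (-1) ^ i) * e + e1)

lemma planarLaguerre_coeff_zero (τ ν : ℝ) (k i : ℕ) (h : k < i) :
    (planarLaguerre τ ν k).coeff i = 0 := by
  unfold planarLaguerre
  split_ifs
  · rw [coeff_X_pow, if_neg (by omega)]
  · rw [coeff_rescale, laguerreL_coeff_zero _ k i h]; simp

lemma planarHermite_zero (τ : ℝ) : planarHermite τ 0 = 1 := by
  unfold planarHermite
  split_ifs <;> simp [hermiteH]

lemma planarLaguerre_zero (τ ν : ℝ) : planarLaguerre τ ν 0 = 1 := by
  unfold planarLaguerre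
  split_ifs <;> simp [laguerreL, poch_zero]

lemma planarGegenbauer_zero (τ a : ℝ) : planarGegenbauer τ a 0 = 1 := by
  unfold planarGegenbauer
  split_ifs <;> simp [gegenbauerC, poch_zero]

/-- Coefficients are compared one by one. Those of the wrong parity vanish; the others are explicit
multiples of a common factor. -/
lemma planarHermite_hasRecurrence (τ : ℝ) (hτ : 0 ≤ τ) :
    HasRecurrence (planarHermiteSeq τ hτ) (fun _ => 0) (fun n => τ * n) := by
  refine ⟨by simp, fun k => ?_⟩
  change X * planarHermite τ k = planarHermite τ (k + 1) + C 0 * planarHermite τ k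
    + C (τ * ((k : ℤ) : ℝ)) * planarHermite τ (k - 1)
  ext n
  rw [C_0, zero_mul, add_zero, coeff_add, coeff_C_mul]
  simp only [Int.cast_natCast]
  by_cases hn : ∃ m, n + 2 * m = k + 1
  · obtain ⟨m, hm⟩ := hn
    have h1 := planarHermite_coeff hτ n m
    rcases m with _ | m
    · obtain rfl : n = k + 1 := by omega
      have h2 := planarHermite_coeff hτ k 0
      rw [mul_zero, add_zero] at h1 h2
      rw [coeff_X_mul, h1, h2, planarHermite_coeff_zero _ _ _ (by omega)]
      push_cast [Nat.factorial_succ]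
      field_simp
      ring
    · rcases k with _ | k
      · omega
      obtain rfl : k = n + 2 * m := by omega
      rw [show n + 2 * (m + 1) = n + 2 * m + 1 + 1 by omega] at h1
      rw [Nat.add_sub_cancel, planarHermite_coeff hτ, h1]
      rcases n with _ | n
      · rw [coeff_X_mul_zero]
        push_cast [Nat.factorial_succ]
        field_simp
        ring
      · have h2 := planarHermite_coeff hτ n (m + 1)
        rw [show n + 2 * (m + 1) = n + 1 + 2 * m + 1 by omega] at h2
        rw [coeff_X_mul, h2]
        push_cast [Nat.factorial_succ]
        field_simp
        ring
  · push Not at hn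
    rw [planarHermite_coeff_zero _ _ _ hn]
    -- The factor k removes the case k = 0, in which the truncated index k - 1 would be 0.
    have h2 : (k : ℝ) * (planarHermite τ (k - 1)).coeff n = 0 := by
      rcases k with _ | k
      · simp
      · rw [planarHermite_coeff_zero _ _ _ fun m h => hn (m + 1) (by omega), mul_zero]
    rw [mul_assoc, h2]
    rcases n with _ | n
    · simp
    · rw [coeff_X_mul, planarHermite_coeff_zero _ _ _ fun m h => hn m (by omega)]; simp

lemma planarGegenbauer_hasRecurrence (τ a : ℝ) (hτ : 0 ≤ τ) (ha : -1 < a) :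
    HasRecurrence (planarGegenbauerSeq τ a hτ ha) (fun _ => 0)
      (fun n => τ * (n * (n + 2 * a + 1)) / (4 * ((n + a) * (n + a + 1)))) := by
  -- At n = 0 the numerator of c_n vanishes; if also a = 0 the quotient is 0/0, which is read as 0.
  refine ⟨by simp, fun k => ?_⟩
  change X * planarGegenbauer τ a k = planarGegenbauer τ a (k + 1) + C 0 * planarGegenbauer τ a k
    + C _ * planarGegenbauer τ a (k - 1)
  have hp := fun n => (poch_pos (show 0 < 1 + a by linarith) n).ne'
  have hq : ∀ i : ℕ, (1 + a + i : ℝ) ≠ 0 := fun i => by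
    have : (0 : ℝ) ≤ i := by positivity
    linarith
  ext n
  rw [C_0, zero_mul, add_zero, coeff_add, coeff_C_mul]
  simp only [Int.cast_natCast]
  by_cases hn : ∃ m, n + 2 * m = k + 1
  · obtain ⟨m, hm⟩ := hn
    have h1 := planarGegenbauer_coeff hτ ha n m
    rcases m with _ | m
    · obtain rfl : n = k + 1 := by omega
      have h2 := planarGegenbauer_coeff hτ ha k 0
      rw [mul_zero, add_zero] at h1 h2
      rw [coeff_X_mul, h1, h2, planarGegenbauer_coeff_zero _ _ _ _ (by omega)]
      have := hp k
      have := hp (k + 1)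
      field_simp
      ring
    · rcases k with _ | k
      · omega
      obtain rfl : k = n + 2 * m := by omega
      rw [show n + 2 * (m + 1) = n + 2 * m + 1 + 1 by omega,
        show n + (m + 1) = n + m + 1 by omega, poch_succ, poch_succ, poch_succ] at h1
      rw [Nat.add_sub_cancel, planarGegenbauer_coeff hτ ha, h1]
      have hp1 := hp (n + 2 * m)
      have hq1 := hq (n + 2 * m)
      have hq2 := hq (n + 2 * m + 1)
      have e1 : ((n + 2 * m + 1 : ℕ) : ℝ) + a = 1 + a + (n + 2 * m : ℕ) := by push_cast; ring
      have e2 : 1 + a + ((n + 2 * m : ℕ) : ℝ) + 1 = 1 + a + (n + 2 * m + 1 : ℕ) := by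
        push_cast; ring
      rw [e1, e2]
      rcases n with _ | n
      · rw [coeff_X_mul_zero]
        generalize poch (1 + a) (0 + 2 * m) = P at *
        push_cast [Nat.factorial_succ] at *
        field_simp
        ring
      · have h2 := planarGegenbauer_coeff hτ ha n (m + 1)
        rw [show n + 2 * (m + 1) = n + 1 + 2 * m + 1 by omega,
          show n + (m + 1) = n + 1 + m by omega, poch_succ _ (n + 1 + 2 * m)] at h2
        rw [coeff_X_mul, h2]
        generalize poch (1 + a) (n + 1 + 2 * m) = P at *
        generalize poch (1 + a) (n + 1 + m) = Q at *
        push_cast [Nat.factorial_succ] at *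
        field_simp
        ring
  · push Not at hn
    rw [planarGegenbauer_coeff_zero _ _ _ _ hn]
    have h2 : (k : ℝ) * (planarGegenbauer τ a (k - 1)).coeff n = 0 := by
      rcases k with _ | k
      · simp
      · rw [planarGegenbauer_coeff_zero _ _ _ _ fun m h => hn (m + 1) (by omega), mul_zero]
    have h3 : (X * planarGegenbauer τ a k).coeff n = 0 := by
      rcases n with _ | n
      · simp
      · rw [coeff_X_mul, planarGegenbauer_coeff_zero _ _ _ _ fun m h => hn m (by omega)]
    rw [h3]
    linear_combination -(τ * (k + 2 * a + 1) / (4 * ((k + a) * (k + a + 1)))) * h2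

/-- With k + 1 = i + d, every coefficient of X^i is a multiple of (-τ)^d k!/(d! i!) times a
Pochhammer symbol of length d, d - 1 or d - 2, and the recurrence becomes a polynomial identity in
i, d and ν. -/
lemma planarLaguerre_hasRecurrence (τ ν : ℝ) :
    HasRecurrence (planarLaguerreSeq τ ν) (fun n => τ * (2 * n + ν + 1))
      (fun n => τ ^ 2 * (n * (n + ν))) := by
  refine ⟨by simp, fun k => ?_⟩
  change X * planarLaguerre τ ν k = planarLaguerre τ ν (k + 1) + C _ * planarLaguerre τ ν k
    + C _ * planarLaguerre τ ν (k - 1)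
  ext i
  rw [coeff_add, coeff_add, coeff_C_mul, coeff_C_mul]
  simp only [Int.cast_natCast]
  have hX : (X * planarLaguerre τ ν k).coeff i
      = if i = 0 then 0 else (planarLaguerre τ ν k).coeff (i - 1) := by
    rcases i with _ | i
    · simp
    · simp [coeff_X_mul]
  rw [hX]
  rcases lt_or_ge (k + 1) i with h | h
  · rw [if_neg (by omega), planarLaguerre_coeff_zero _ _ _ _ h,
      planarLaguerre_coeff_zero _ _ k (i - 1) (by omega),
      planarLaguerre_coeff_zero _ _ k _ (by omega),
      planarLaguerre_coeff_zero _ _ (k - 1) _ (by omega)]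
    ring
  obtain ⟨d, hd⟩ := Nat.exists_eq_add_of_le h
  have h1 := planarLaguerre_coeff τ ν i d
  rw [← hd] at h1
  rw [h1]
  have hX' : (if i = 0 then 0 else (planarLaguerre τ ν k).coeff (i - 1))
      = i * ((-τ) ^ d * (k ! : ℝ) * poch (ν + i) d / (d ! * i !)) := by
    rcases i with _ | i
    · simp
    · have h2 := planarLaguerre_coeff τ ν i d
      rw [show i + d = k by omega] at h2
      rw [if_neg (by omega), Nat.add_sub_cancel, h2]
      push_cast [Nat.factorial_succ]
      field_simp
      ring_nf
  rw [hX']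
  -- The missing power of τ is multiplied in, not divided out, so τ = 0 is covered.
  have h3 : (planarLaguerre τ ν k).coeff i * (-τ)
      = d * ((-τ) ^ d * (k ! : ℝ) * poch (ν + i + 1) (d - 1) / (d ! * i !)) := by
    rcases d with _ | d
    · rw [planarLaguerre_coeff_zero _ _ _ _ (by omega)]; simp
    · obtain rfl : k = i + d := by omega
      rw [planarLaguerre_coeff, Nat.add_sub_cancel]
      push_cast [Nat.factorial_succ]
      field_simp
      ring
  have h4 : (planarLaguerre τ ν (k - 1)).coeff i * τ ^ 2 * k
      = d * (d - 1) * ((-τ) ^ d * (k ! : ℝ) * poch (ν + i + 1) (d - 2) / (d ! * i !)) := by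
    rcases d with _ | _ | d
    · rcases k with _ | k
      · simp
      · rw [planarLaguerre_coeff_zero _ _ _ _ (by omega)]; simp
    · rcases k with _ | k
      · simp
      · rw [planarLaguerre_coeff_zero _ _ _ _ (by omega)]; simp
    · obtain rfl : k = i + d + 1 := by omega
      rw [Nat.add_sub_cancel, planarLaguerre_coeff, show d + 1 + 1 - 2 = d by omega]
      push_cast [Nat.factorial_succ]
      field_simp
      ring
  have h5 : τ * (2 * (k : ℝ) + ν + 1) * (planarLaguerre τ ν k).coeff i
      = -(2 * (k : ℝ) + ν + 1)
        * (d * ((-τ) ^ d * (k ! : ℝ) * poch (ν + i + 1) (d - 1) / (d ! * i !))) := by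
    rw [← h3]; ring
  have h6 : τ ^ 2 * ((k : ℝ) * (k + ν)) * (planarLaguerre τ ν (k - 1)).coeff i
      = (k + ν)
        * (d * (d - 1) * ((-τ) ^ d * (k ! : ℝ) * poch (ν + i + 1) (d - 2) / (d ! * i !))) := by
    rw [← h4]; ring
  have hk : (k : ℝ) = i + d - 1 := by
    have : ((k + 1 : ℕ) : ℝ) = ((i + d : ℕ) : ℝ) := by rw [hd]
    push_cast at this
    linarith
  rw [h5, h6, Nat.factorial_succ]
  push_cast
  -- For d = 0, 1 the lengths d - 1 and d - 2 may be truncated, but the prefactors d and d(d - 1)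
  -- then vanish. For larger d all symbols reduce to the one of length d.
  rcases d with _ | _ | d
  · simp only [poch_zero, hk]
    push_cast
    ring
  · simp only [zero_add, poch_succ, poch_zero, hk, Nat.sub_self]
    push_cast
    ring
  · have e1 : poch (ν + i) (d + 1 + 1) = (ν + i) * (poch (ν + i + 1) d * (ν + i + 1 + d)) := by
      rw [poch_succ_left, poch_succ]
    rw [e1, poch_succ, show d + 1 + 1 - 1 = d + 1 by omega, show d + 1 + 1 - 2 = d by omega,
      poch_succ]
    rw [hk]
    push_cast
    ring

/-! ### Hermite polynomials -/

/-- The coefficient of `p_n` in `z^p` for the planar Hermite polynomials. -/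
def hermiteMonomial (τ : ℝ) (p : ℕ) (n : ℤ) : ℝ :=
  if Even ((p : ℤ) - n) then p ! * powFact (τ / 2) ((p - n) / 2) * invFact n else 0

/-- The coefficient of `p_j` in `p_m p_k` for the planar Hermite polynomials. -/
def hermiteLinearization (τ : ℝ) (k m : ℕ) (j : ℤ) : ℝ :=
  if Even ((m : ℤ) + k - j) then
    m ! * k ! * powFact τ ((m + k - j) / 2) * invFact ((m + j - k) / 2) * invFact ((j + k - m) / 2)
  else 0

lemma hermiteMonomial_zero (τ : ℝ) (n : ℤ) :
    hermiteMonomial τ 0 n = if n = 0 then 1 else 0 := by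
  unfold hermiteMonomial
  split_ifs with h1 h2 h2
  · subst h2; simp [powFact_zero, invFact_zero]
  · rcases lt_or_gt_of_ne h2 with h | h
    · rw [invFact_of_neg h, mul_zero]
    · rw [powFact_of_neg _ (by push_cast; omega)]; simp
  · subst h2; simp at h1
  · rfl

/-- Writing p + 1 = n + 2l splits (p + 1)! into two parts: n p! gives the first term and 2l p! the
second. -/
lemma hermiteMonomial_succ (τ : ℝ) (p : ℕ) (n : ℤ) :
    hermiteMonomial τ (p + 1) n
      = hermiteMonomial τ p (n - 1) + τ * ((n + 1 : ℤ) : ℝ) * hermiteMonomial τ p (n + 1) := by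
  unfold hermiteMonomial
  by_cases h : Even (((p + 1 : ℕ) : ℤ) - n)
  · obtain ⟨l, hl⟩ := h
    push_cast at hl
    rw [if_pos ⟨l, by push_cast; omega⟩, if_pos ⟨l, by omega⟩, if_pos ⟨l - 1, by omega⟩,
      show (((p + 1 : ℕ) : ℤ) - n) / 2 = l by push_cast; omega,
      show ((p : ℤ) - (n - 1)) / 2 = l by omega, show ((p : ℤ) - (n + 1)) / 2 = l - 1 by omega]
    have h1 := mul_powFact_sub_one (τ / 2) l
    have h2 := invFact_sub_one n
    have h3 := invFact_sub_one (n + 1)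
    rw [add_sub_cancel_right] at h3
    have h4 : (p : ℝ) + 1 = n + 2 * l := by
      have : ((p + 1 : ℤ) : ℝ) = ((n + 2 * l : ℤ) : ℝ) := by congr 1; omega
      push_cast at this; exact this
    rw [h2, Nat.factorial_succ]
    push_cast at h3 ⊢
    rw [h4]
    linear_combination (-2 * (p ! : ℝ) * invFact n) * h1
      + (τ * powFact (τ / 2) (l - 1) * p !) * h3
  · rw [if_neg h, if_neg, if_neg]
    · simp
    · intro h'; apply h; obtain ⟨l, hl⟩ := h'; exact ⟨l + 1, by push_cast; omega⟩
    · intro h'; apply h; obtain ⟨l, hl⟩ := h'; exact ⟨l, by push_cast; omega⟩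

lemma hermiteLinearization_zero (τ : ℝ) (k : ℕ) (j : ℤ) :
    hermiteLinearization τ k 0 j = if j = k then 1 else 0 := by
  unfold hermiteLinearization
  split_ifs with h1 h2 h2
  · subst h2
    have : (k ! : ℝ) ≠ 0 := by positivity
    rw [show (((0 : ℕ) : ℤ) + k - k) / 2 = 0 by simp,
      show ((k : ℤ) + k - ((0 : ℕ) : ℤ)) / 2 = k by push_cast; omega, powFact_zero, invFact_zero,
      invFact_natCast]
    simp [this]
  · obtain ⟨l, hl⟩ := h1
    push_cast at hl
    rcases lt_or_gt_of_ne h2 with h | h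
    · rw [invFact_of_neg (n := (((0 : ℕ) : ℤ) + j - k) / 2) (by push_cast; omega)]; simp
    · rw [powFact_of_neg _ (by push_cast; omega)]; simp
  · subst h2; simp at h1
  · rfl

/-- With m + 1 = α + β, k = α + γ and j = β + γ, the left side is proportional to (α + β) τ^α/(α! β!
γ!). The part with β is the term at j - 1. The other two terms give the part with α, because (β + γ
+ 1) - β = γ + 1 lowers (γ + 1)! to γ!. -/
lemma hermiteLinearization_succ (τ : ℝ) (k m : ℕ) (j : ℤ) :
    hermiteLinearization τ k (m + 1) j
      = hermiteLinearization τ k m (j - 1)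
        + τ * ((j + 1 : ℤ) : ℝ) * hermiteLinearization τ k m (j + 1)
        - τ * m * hermiteLinearization τ k (m - 1) j := by
  -- The factor m completes (m - 1)! to m!. For m = 0 the right side vanishes too: the first two
  -- shifted indices sum to -1, so one of them is negative.
  have hlast : (m : ℝ) * hermiteLinearization τ k (m - 1) j
      = if Even ((m : ℤ) + 1 + k - j) then m ! * k ! * powFact τ ((m + 1 + k - j) / 2 - 1)
        * invFact ((m + 1 + j - k) / 2 - 1) * invFact ((j + k - m - 1) / 2 + 1) else 0 := by
    unfold hermiteLinearization
    rcases m with _ | m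
    · rw [Nat.cast_zero, zero_mul]
      split_ifs with h1
      · have : ¬ (0 ≤ (((0 : ℕ) : ℤ) + 1 + k - j) / 2 - 1
            ∧ 0 ≤ (((0 : ℕ) : ℤ) + 1 + j - k) / 2 - 1) := by push_cast; omega
        by_cases h3 : 0 ≤ (((0 : ℕ) : ℤ) + 1 + k - j) / 2 - 1
        · rw [invFact_of_neg (n := (((0 : ℕ) : ℤ) + 1 + j - k) / 2 - 1) (by omega)]; simp
        · rw [powFact_of_neg _ (by omega)]; simp
      · rfl
    · rw [Nat.add_sub_cancel]
      have hE : Even (((m + 1 : ℕ) : ℤ) + 1 + k - j) ↔ Even ((m : ℤ) + k - j) := by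
        rw [show ((m + 1 : ℕ) : ℤ) + 1 + k - j = (m + k - j) + 2 by push_cast; ring]
        simp
      simp only [hE]
      split_ifs with h1
      · obtain ⟨l, hl⟩ := h1
        rw [show (((m + 1 : ℕ) : ℤ) + 1 + k - j) / 2 - 1 = (m + k - j) / 2 by push_cast; omega,
          show (((m + 1 : ℕ) : ℤ) + 1 + j - k) / 2 - 1 = (m + j - k) / 2 by push_cast; omega,
          show (j + k - ((m + 1 : ℕ) : ℤ) - 1) / 2 + 1 = (j + k - m) / 2 by push_cast; omega,
          Nat.factorial_succ]
        push_cast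
        ring
      · simp
  rw [mul_assoc τ (m : ℝ), hlast]
  unfold hermiteLinearization
  by_cases h : Even ((m : ℤ) + 1 + k - j)
  · obtain ⟨α, hα⟩ := h
    obtain ⟨β, hβ⟩ : ∃ β : ℤ, (m : ℤ) + 1 + j - k = 2 * β := ⟨m + 1 - α, by omega⟩
    obtain ⟨γ, hγ⟩ : ∃ γ : ℤ, j + k - m - 1 = 2 * γ := ⟨k - α, by omega⟩
    rw [if_pos ⟨α, by push_cast; omega⟩, if_pos ⟨α, by omega⟩, if_pos ⟨α - 1, by omega⟩,
      if_pos ⟨α, hα⟩,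
      show (((m + 1 : ℕ) : ℤ) + k - j) / 2 = α by push_cast; omega,
      show (((m + 1 : ℕ) : ℤ) + j - k) / 2 = β by push_cast; omega,
      show (j + k - ((m + 1 : ℕ) : ℤ)) / 2 = γ by push_cast; omega,
      show ((m : ℤ) + k - (j - 1)) / 2 = α by omega,
      show ((m : ℤ) + (j - 1) - k) / 2 = β - 1 by omega,
      show (j - 1 + k - (m : ℤ)) / 2 = γ by omega,
      show ((m : ℤ) + k - (j + 1)) / 2 = α - 1 by omega,
      show ((m : ℤ) + (j + 1) - k) / 2 = β by omega,
      show (j + 1 + k - (m : ℤ)) / 2 = γ + 1 by omega,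
      show ((m : ℤ) + 1 + k - j) / 2 = α by omega,
      show ((m : ℤ) + 1 + j - k) / 2 = β by omega,
      show (j + k - (m : ℤ) - 1) / 2 = γ by omega]
    have h1 := mul_powFact_sub_one τ α
    have h2 := invFact_sub_one β
    have h3 := invFact_sub_one (γ + 1)
    rw [add_sub_cancel_right] at h3
    have h4 : (m : ℝ) + 1 = α + β := by
      have : ((m + 1 : ℤ) : ℝ) = ((α + β : ℤ) : ℝ) := by congr 1; omega
      push_cast at this; exact this
    have h5 : j = β + γ := by omega
    rw [h2, h3, Nat.factorial_succ, h5]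
    push_cast
    rw [h4]
    linear_combination (-(m ! : ℝ) * k ! * invFact β * invFact (γ + 1) * (γ + 1)) * h1
  · rw [if_neg, if_neg, if_neg, if_neg h]
    · simp
    · intro h'; apply h; obtain ⟨l, hl⟩ := h'; exact ⟨l + 1, by omega⟩
    · intro h'; apply h; obtain ⟨l, hl⟩ := h'; exact ⟨l, by omega⟩
    · intro h'; apply h; obtain ⟨l, hl⟩ := h'; exact ⟨l, by push_cast at hl; omega⟩

lemma coord_hermite_X_pow (τ : ℝ) (hτ : 0 ≤ τ) (p : ℕ) (n : ℤ) :
    coord (planarHermiteSeq τ hτ) (X ^ p) n = hermiteMonomial τ p n :=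
  coord_X_pow_eq (planarHermite_hasRecurrence τ hτ) (planarHermite_zero τ) _
    (hermiteMonomial_zero τ) (fun p j => by simp [hermiteMonomial_succ]) p n

lemma coord_hermite_mul (τ : ℝ) (hτ : 0 ≤ τ) (m k : ℕ) (j : ℤ) :
    coord (planarHermiteSeq τ hτ) (planarHermiteSeq τ hτ m * planarHermiteSeq τ hτ k) j
      = hermiteLinearization τ k m j :=
  coord_mul_eq (planarHermite_hasRecurrence τ hτ) (planarHermite_zero τ) k _
    (hermiteLinearization_zero τ k) (fun m j => by simp [hermiteLinearization_succ]) m j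

lemma mulPowCoeff_hermite (τ : ℝ) (hτ : 0 ≤ τ) (p j k : ℕ) :
    mulPowCoeff (planarHermiteSeq τ hτ) p j k
      = ∑ l ∈ Finset.range (p / 2 + 1),
          hermiteMonomial τ p ((p - 2 * l : ℕ) : ℤ) * hermiteLinearization τ k (p - 2 * l) j := by
  rw [mulPowCoeff_eq_sum_step_two]
  · simp only [coord_hermite_X_pow, coord_hermite_mul]
  · intro n hn
    rw [coord_hermite_X_pow, hermiteMonomial]
    split_ifs with h
    · obtain ⟨l, hl⟩ := h
      rw [powFact_of_neg]
      · simp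
      · by_contra h0
        exact hn l.toNat (by omega)
    · rfl

/-- Here r = (p + k - j)/2 and s = (p - k + j)/2, so membership says that both halves are
nonnegative integers. This makes the integer divisions in the formulas exact. -/
lemma sub_mem_stepRange {p j k : ℕ} :
    (j : ℤ) - k ∈ stepRange p ↔ ∃ r s : ℤ, 0 ≤ r ∧ 0 ≤ s ∧ r + s = p ∧ r + j = s + k := by
  constructor
  · rintro ⟨i, hi, h⟩
    exact ⟨p - i, i, by omega, by omega, by omega, by omega⟩
  · rintro ⟨r, s, hr, hs, h1, h2⟩
    exact ⟨s.toNat, by omega, by omega⟩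

/-- The expansion coefficients for the planar Hermite polynomials. -/
theorem mulPowCoeff_planarHermite (τ : ℝ) (hτ : 0 ≤ τ) (p j k : ℕ)
    (h : (j : ℤ) - k ∈ stepRange p) :
    mulPowCoeff (planarHermiteSeq τ hτ) p j k
      = τ ^ (((p : ℤ) + k - j) / 2)
        * ∑ l ∈ Finset.range (p / 2 + 1),
            (p ! : ℝ) / (2 ^ l * l !) * invFact (((p : ℤ) - k + j) / 2 - l)
              * intBinom k (((p : ℤ) + k - j) / 2 - l) := by
  obtain ⟨r, s, hr, hs, hrs, hjk⟩ := sub_mem_stepRange.1 h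
  rw [mulPowCoeff_hermite, Finset.mul_sum]
  refine Finset.sum_congr rfl fun l hl => ?_
  have hl : 2 * l ≤ p := by have := Finset.mem_range.1 hl; omega
  obtain ⟨m, rfl⟩ := Nat.exists_eq_add_of_le' hl
  rw [Nat.add_sub_cancel, hermiteMonomial, hermiteLinearization, if_pos ⟨l, by push_cast; omega⟩,
    if_pos ⟨r - l, by push_cast at *; omega⟩, show (((m + 2 * l : ℕ) : ℤ) - m) / 2 = l by
      push_cast; omega,
    show (((m + 2 * l : ℕ) : ℤ) - k + j) / 2 = s by omega,
    show (((m + 2 * l : ℕ) : ℤ) + k - j) / 2 = r by omega,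
    show ((m : ℤ) + k - j) / 2 = r - l by push_cast at *; omega,
    show ((m : ℤ) + j - k) / 2 = s - l by push_cast at *; omega,
    show ((j : ℤ) + k - m) / 2 = k - (r - l) by push_cast at *; omega, invFact_natCast]
  lift r to ℕ using hr
  -- For l > r both sides vanish: on the left through the power factor of negative index, on the
  -- right through the binomial.
  rcases lt_or_ge r l with h1 | h1
  · rw [powFact_of_neg τ (by omega), intBinom, if_neg (by omega)]; simp
  obtain ⟨i, rfl⟩ := Nat.exists_eq_add_of_le' h1
  rw [show ((i + l : ℕ) : ℤ) - l = i by push_cast; ring, powFact, powFact, invFact_natCast,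
    invFact_natCast, Int.toNat_natCast, Int.toNat_natCast, intBinom, if_pos (by omega),
    Int.toNat_natCast, zpow_natCast, pow_add, div_pow]
  have hm : (m ! : ℝ) ≠ 0 := by positivity
  rcases lt_or_ge k i with h2 | h2
  · rw [invFact_of_neg (n := (k : ℤ) - i) (by omega), Nat.choose_eq_zero_of_lt h2]; simp
  · obtain ⟨d, rfl⟩ := Nat.exists_eq_add_of_le' h2
    rw [show ((d + i : ℕ) : ℤ) - i = d by push_cast; ring, invFact_natCast,
      Nat.add_choose]
    have hdvd : (i ! * d !) ∣ (d + i)! := by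
      rw [mul_comm]; exact Nat.factorial_mul_factorial_dvd_factorial_add d i
    rw [mul_comm d !, Nat.cast_div hdvd (by positivity)]
    push_cast
    field_simp

/-- A nonzero term supplies α ≥ 0 and m - α ≥ 0, and then r = α + l, s = m - α + l witness
membership. -/
theorem mulPowCoeff_planarHermite_eq_zero (τ : ℝ) (hτ : 0 ≤ τ) (p j k : ℕ)
    (h : (j : ℤ) - k ∉ stepRange p) : mulPowCoeff (planarHermiteSeq τ hτ) p j k = 0 := by
  rw [mulPowCoeff_hermite]
  refine Finset.sum_eq_zero fun l hl => ?_
  have hl : 2 * l ≤ p := by have := Finset.mem_range.1 hl; omega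
  obtain ⟨m, rfl⟩ := Nat.exists_eq_add_of_le' hl
  rw [Nat.add_sub_cancel, hermiteLinearization]
  split_ifs with hE
  · obtain ⟨α, hα⟩ := hE
    rcases lt_or_ge α 0 with h1 | h1
    · rw [powFact_of_neg _ (by omega)]; simp
    rcases lt_or_ge ((m : ℤ) - α) 0 with h2 | h2
    · rw [invFact_of_neg (n := ((m : ℤ) + j - k) / 2) (by omega)]; simp
    · exact absurd (sub_mem_stepRange.2 ⟨α + l, m - α + l, by omega, by omega,
        by push_cast; omega, by omega⟩) h
  · simp

/-! ### Laguerre polynomials -/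

/-- The summand of the linearization coefficients of Laguerre polynomials. -/
def laguerreTerm (ν : ℝ) (j k m : ℤ) (s : ℕ) : ℝ :=
  Real.Gamma (s + ν + 1) * 2 ^ (j + k + m - 2 * s) * invFact (s - j) * invFact (s - k)
    * invFact (s - m) * invFact (j + k + m - 2 * s)

/-- The sum in the linearization coefficients of Laguerre polynomials. -/
def laguerreSum (ν : ℝ) (j k m : ℤ) : ℝ :=
  ∑ s ∈ Finset.range (j + k + m + 1).toNat, laguerreTerm ν j k m s

lemma laguerreTerm_eq_zero (ν : ℝ) {j k m : ℤ} {s : ℕ}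
    (h : (s : ℤ) < j ∨ (s : ℤ) < k ∨ (s : ℤ) < m ∨ j + k + m < 2 * s) :
    laguerreTerm ν j k m s = 0 := by
  unfold laguerreTerm
  rcases h with h | h | h | h
  · rw [invFact_of_neg (n := s - j) (by omega)]; simp
  · rw [invFact_of_neg (n := s - k) (by omega)]; simp
  · rw [invFact_of_neg (n := s - m) (by omega)]; simp
  · rw [invFact_of_neg (n := j + k + m - 2 * s) (by omega)]; simp

lemma laguerreSum_eq (ν : ℝ) (j k m : ℤ) {N : ℕ} (hN : j + k + m < N) :
    laguerreSum ν j k m = ∑ s ∈ Finset.range N, laguerreTerm ν j k m s := by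
  refine Finset.sum_subset (fun s hs => ?_) fun s _ hs => ?_
  · rw [Finset.mem_range] at *; omega
  · rw [Finset.mem_range] at hs
    exact laguerreTerm_eq_zero ν (by omega)

lemma laguerreSum_eq_zero (ν : ℝ) {j k m : ℤ} (h : k + m < j ∨ j + m < k ∨ j + k < m) :
    laguerreSum ν j k m = 0 :=
  Finset.sum_eq_zero fun s _ => laguerreTerm_eq_zero ν (by omega)

/-- The contiguous relation that makes `laguerreSum` satisfy the three-term recurrence. -/
lemma laguerreSum_contiguous {ν : ℝ} (hν : -1 < ν) (j k m : ℤ) (hk : 0 ≤ k) :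
    (m + 1) * laguerreSum ν j k (m + 1) + (m + ν) * laguerreSum ν j k (m - 1)
        + 2 * m * laguerreSum ν j k m
      = (j + 1) * laguerreSum ν (j + 1) k m + (j + ν) * laguerreSum ν (j - 1) k m
        + 2 * j * laguerreSum ν j k m := by
  -- Telescoping certificate in the sense of Zeilberger. The relation mirrors the fact that in a
  -- triple integral of Laguerre polynomials multiplication by x can be applied to the factor of
  -- index m or to that of index j.
  let H : ℕ → ℝ := fun s => 2 * ((j : ℝ) - m) * Real.Gamma (s + ν + 1)
    * 2 ^ (j + k + m - 2 * s) * invFact (s - j) * invFact (s - k - 1) * invFact (s - m)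
    * invFact (j + k + m - 2 * s + 1)
  have key : ∀ s : ℕ,
      (m + 1) * laguerreTerm ν j k (m + 1) s + (m + ν) * laguerreTerm ν j k (m - 1) s
        + 2 * m * laguerreTerm ν j k m s
        - ((j + 1) * laguerreTerm ν (j + 1) k m s + (j + ν) * laguerreTerm ν (j - 1) k m s
        + 2 * j * laguerreTerm ν j k m s) = H s - H (s + 1) := by
    intro s
    have hs : (0 : ℝ) ≤ s := by positivity
    simp only [H, laguerreTerm]
    have hΓ : Real.Gamma (((s + 1 : ℕ) : ℝ) + ν + 1) = (s + ν + 1) * Real.Gamma (s + ν + 1) := by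
      rw [show ((s + 1 : ℕ) : ℝ) + ν + 1 = (s + ν + 1) + 1 by push_cast; ring,
        Real.Gamma_add_one (by linarith)]
    obtain ⟨w, hw⟩ : ∃ w : ℤ, w = j + k + m - 2 * s := ⟨_, rfl⟩
    rw [hΓ, show j + k + (m + 1) - 2 * (s : ℤ) = w + 1 by omega,
      show j + k + (m - 1) - 2 * (s : ℤ) = w - 1 by omega,
      show j + 1 + k + m - 2 * (s : ℤ) = w + 1 by omega,
      show j - 1 + k + m - 2 * (s : ℤ) = w - 1 by omega,
      show j + k + m - 2 * ((s + 1 : ℕ) : ℤ) = w - 2 by push_cast; omega, ← hw,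
      show (s : ℤ) - (m + 1) = s - m - 1 by ring, show (s : ℤ) - (j + 1) = s - j - 1 by ring,
      show (s : ℤ) - (m - 1) = s - m + 1 by ring, show (s : ℤ) - (j - 1) = s - j + 1 by ring,
      show ((s + 1 : ℕ) : ℤ) - m = s - m + 1 by push_cast; ring,
      show ((s + 1 : ℕ) : ℤ) - j = s - j + 1 by push_cast; ring,
      show ((s + 1 : ℕ) : ℤ) - k - 1 = s - k by push_cast; ring,
      show w - 2 + 1 = w - 1 by ring]
    have p2 : (2 : ℝ) ≠ 0 := by norm_num
    have p1 : (2 : ℝ) ^ (w - 2) = 2 ^ w / 4 := by rw [zpow_sub₀ p2]; norm_num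
    rw [zpow_add_one₀ p2, zpow_sub_one₀ p2, p1]
    have a1 := invFact_sub_one (s - j + 1)
    have a2 := invFact_sub_one (s - j)
    have b1 := invFact_sub_one (s - m + 1)
    have b2 := invFact_sub_one (s - m)
    have c1 := invFact_sub_one (s - k)
    have d1 := invFact_sub_one (w + 1)
    have d2 := invFact_sub_one w
    rw [add_sub_cancel_right] at a1 b1 d1
    -- All reciprocal factorials are now multiples of those at s - j + 1, s - k, s - m + 1 and w +
    -- 1, so a polynomial identity remains.
    rw [a2, b2, c1, d2, a1, b1, d1]
    have hw' : (w : ℝ) = j + k + m - 2 * s := by rw [hw]; push_cast; ring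
    generalize (2 : ℝ) ^ w = P
    push_cast
    rw [hw']
    ring
  obtain ⟨N, hN⟩ : ∃ N : ℕ, j + k + m + 1 < N := ⟨(j + k + m + 2).toNat, by omega⟩
  rw [laguerreSum_eq ν j k (m + 1) (N := N) (by omega),
    laguerreSum_eq ν j k (m - 1) (N := N) (by omega), laguerreSum_eq ν j k m (N := N) (by omega),
    laguerreSum_eq ν (j + 1) k m (N := N) (by omega),
    laguerreSum_eq ν (j - 1) k m (N := N) (by omega), ← sub_eq_zero]
  simp only [Finset.mul_sum, ← Finset.sum_add_distrib, ← Finset.sum_sub_distrib]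
  rw [Finset.sum_congr rfl fun s _ => key s, Finset.sum_range_sub']
  simp only [H]
  -- Both ends of the telescope vanish: H 0 through 1/(-k - 1)!, which needs k ≥ 0, and H N by the
  -- choice of N.
  rw [invFact_of_neg (n := ((0 : ℕ) : ℤ) - k - 1) (by push_cast; omega),
    invFact_of_neg (n := j + k + m - 2 * N + 1) (by omega)]
  simp

/-- The coefficient of `p_n` in `z^p` for the planar Laguerre polynomials. -/
def laguerreMonomial (τ ν : ℝ) (p : ℕ) (n : ℤ) : ℝ :=
  p ! * (Real.Gamma (p + ν + 1) / Real.Gamma (n + ν + 1)) * powFact τ (p - n) * invFact n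

/-- The coefficient of `p_j` in `p_m p_k` for the planar Laguerre polynomials. -/
def laguerreLinearization (τ ν : ℝ) (k m : ℕ) (j : ℤ) : ℝ :=
  τ ^ ((m : ℤ) + k - j).toNat * (m ! * k ! / Real.Gamma (j + ν + 1)) * laguerreSum ν j k m

lemma gamma_add_pos {ν : ℝ} (hν : -1 < ν) {n : ℤ} (hn : 0 ≤ n) :
    0 < Real.Gamma (n + ν + 1) := by
  have : (0 : ℝ) ≤ n := by exact_mod_cast hn
  exact Real.Gamma_pos_of_pos (by linarith)

lemma gamma_add_succ {ν : ℝ} (hν : -1 < ν) {n : ℤ} (hn : 0 ≤ n) :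
    Real.Gamma (((n + 1 : ℤ) : ℝ) + ν + 1) = (n + ν + 1) * Real.Gamma (n + ν + 1) := by
  have : (0 : ℝ) ≤ n := by exact_mod_cast hn
  rw [show ((n + 1 : ℤ) : ℝ) + ν + 1 = (n + ν + 1) + 1 by push_cast; ring,
    Real.Gamma_add_one (by linarith)]

lemma laguerreMonomial_zero {ν : ℝ} (hν : -1 < ν) (τ : ℝ) (n : ℤ) :
    laguerreMonomial τ ν 0 n = if n = 0 then 1 else 0 := by
  unfold laguerreMonomial
  split_ifs with h
  · subst h
    have := (gamma_add_pos hν le_rfl).ne'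
    push_cast at this ⊢
    simp only [powFact_zero, invFact_zero, div_self this, Nat.factorial_zero]
    simp
  · rcases lt_or_gt_of_ne h with h | h
    · rw [invFact_of_neg h, mul_zero]
    · rw [powFact_of_neg _ (by push_cast; omega)]; simp

/-- With d = p + 1 - n the three terms match the splitting (n + d)(n + d + ν) = n(n + ν) + d(2n + ν
+ 1) + d(d - 1). -/
lemma laguerreMonomial_succ {ν : ℝ} (hν : -1 < ν) (τ : ℝ) (p : ℕ) (n : ℤ) :
    laguerreMonomial τ ν (p + 1) n
      = laguerreMonomial τ ν p (n - 1) + τ * (2 * n + ν + 1) * laguerreMonomial τ ν p n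
        + τ ^ 2 * (((n + 1 : ℤ) : ℝ) * (((n + 1 : ℤ) : ℝ) + ν))
          * laguerreMonomial τ ν p (n + 1) := by
  rcases lt_or_ge n 0 with hn | hn
  · unfold laguerreMonomial
    rw [invFact_of_neg hn, invFact_of_neg (n := n - 1) (by omega)]
    rcases eq_or_ne (n + 1) 0 with h | h
    · rw [h]; simp
    · rw [invFact_of_neg (n := n + 1) (by omega)]; simp
  have hG := (gamma_add_pos hν hn).ne'
  have hn' : (0 : ℝ) ≤ n := by exact_mod_cast hn
  -- Γ(n + ν) is replaced by Γ(n + ν + 1)/(n + ν) only for n ≥ 1. At n = 0, where its argument may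
  -- be nonpositive, the factor n is 0.
  have hprev : laguerreMonomial τ ν p (n - 1)
      = p ! * (Real.Gamma (p + ν + 1) * (n + ν) / Real.Gamma (n + ν + 1)) * powFact τ (p + 1 - n)
        * (n * invFact n) := by
    unfold laguerreMonomial
    rw [invFact_sub_one]
    rcases hn.eq_or_lt with rfl | hn0
    · simp
    · have h2 := gamma_add_succ hν (n := n - 1) (by omega)
      have h3 := gamma_add_pos hν (n := n - 1) (by omega)
      have h4 : (1 : ℝ) ≤ n := by exact_mod_cast hn0
      rw [sub_add_cancel] at h2
      rw [h2, show (p : ℤ) - (n - 1) = p + 1 - n by ring]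
      push_cast at h3 ⊢
      have : (n : ℝ) - 1 + ν + 1 ≠ 0 := by linarith
      rw [show (n : ℝ) - 1 + ν + 1 = n + ν by ring] at this
      rw [show (n : ℝ) - 1 + ν + 1 = n + ν by ring] at *
      field_simp
  have hΓp := gamma_add_succ hν (n := (p : ℤ)) (by omega)
  have hΓn := gamma_add_succ hν hn
  rw [hprev]
  unfold laguerreMonomial
  obtain ⟨d, hd⟩ : ∃ d : ℤ, d = p + 1 - n := ⟨_, rfl⟩
  have e1 := mul_powFact_sub_one τ d
  have e2 := mul_powFact_sub_one τ (d - 1)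
  have e3 := invFact_sub_one (n + 1)
  have hp : (p : ℝ) = n + d - 1 := by
    have : ((p : ℤ) : ℝ) = ((n + d - 1 : ℤ) : ℝ) := by congr 1; omega
    push_cast at this; exact this
  rw [add_sub_cancel_right] at e3
  rw [show ((p + 1 : ℕ) : ℤ) - n = d by push_cast; omega, show (p : ℤ) - n = d - 1 by omega,
    show (p : ℤ) - (n + 1) = d - 1 - 1 by omega, ← hd, hΓn, e3, Nat.factorial_succ]
  push_cast at hΓp e2 ⊢
  rw [hΓp]
  have hq : (n : ℝ) + ν + 1 ≠ 0 := by linarith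
  rw [show (n : ℝ) + 1 + ν = n + ν + 1 by ring]
  generalize Real.Gamma (p + ν + 1) = A
  generalize Real.Gamma (n + ν + 1) = B at *
  rw [hp]
  field_simp
  linear_combination (-(A * invFact (n + 1))) * ((2 * n + ν + d) * e1 + τ * e2)

lemma laguerreLinearization_of_neg (τ ν : ℝ) (k m : ℕ) {j : ℤ} (hj : j < 0) :
    laguerreLinearization τ ν k m j = 0 := by
  rw [laguerreLinearization]
  have : laguerreSum ν j k m = 0 := Finset.sum_eq_zero fun s _ => laguerreTerm_eq_zero ν (by omega)
  rw [this, mul_zero]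

lemma laguerreLinearization_zero {ν : ℝ} (hν : -1 < ν) (τ : ℝ) (k : ℕ) (j : ℤ) :
    laguerreLinearization τ ν k 0 j = if j = k then 1 else 0 := by
  unfold laguerreLinearization
  split_ifs with h
  · subst h
    have hs : laguerreSum ν k k (0 : ℕ) = Real.Gamma (k + ν + 1) * (1 / k !) := by
      rw [laguerreSum, Finset.sum_eq_single k]
      · rw [laguerreTerm, show (k : ℤ) + k + (0 : ℕ) - 2 * k = 0 by push_cast; ring, sub_self,
          show (k : ℤ) - (0 : ℕ) = k by simp, invFact_zero, invFact_natCast]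
        simp
      · intro s _ hs
        exact laguerreTerm_eq_zero ν (by push_cast; omega)
      · intro hk
        exact absurd (Finset.mem_range.2 (by push_cast; omega)) hk
    have := (gamma_add_pos hν (n := k) (by omega)).ne'
    rw [hs]
    push_cast at this ⊢
    simp
    field_simp
  · rw [laguerreSum_eq_zero ν (by push_cast; omega), mul_zero]

/-- All terms carry the factor τ^e m! k!/Γ(j + ν + 1) with e = m + 1 + k - j; what remains is
`laguerreSum_contiguous`. -/
lemma laguerreLinearization_succ {ν : ℝ} (hν : -1 < ν) (τ : ℝ) (k m : ℕ) (j : ℤ) :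
    laguerreLinearization τ ν k (m + 1) j
      = laguerreLinearization τ ν k m (j - 1)
        + τ * (2 * j + ν + 1) * laguerreLinearization τ ν k m j
        + τ ^ 2 * (((j + 1 : ℤ) : ℝ) * (((j + 1 : ℤ) : ℝ) + ν))
          * laguerreLinearization τ ν k m (j + 1)
        - τ * (2 * m + ν + 1) * laguerreLinearization τ ν k m j
        - τ ^ 2 * (m * (m + ν)) * laguerreLinearization τ ν k (m - 1) j := by
  rcases lt_or_ge j 0 with hj | hj
  · rw [laguerreLinearization_of_neg _ _ _ _ hj, laguerreLinearization_of_neg _ _ _ _ hj,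
      laguerreLinearization_of_neg _ _ _ _ hj, laguerreLinearization_of_neg (j := j - 1) _ _ _ _
      (by omega)]
    rcases eq_or_ne (j + 1) 0 with h | h
    · rw [h]; simp
    · rw [laguerreLinearization_of_neg (j := j + 1) _ _ _ _ (by omega)]; simp
  have hG := (gamma_add_pos hν hj).ne'
  have hj' : (0 : ℝ) ≤ j := by exact_mod_cast hj
  obtain ⟨e, he⟩ : ∃ e : ℤ, e = m + 1 + k - j := ⟨_, rfl⟩
  -- Exponents are truncated at 0, but whenever truncation occurs the accompanying sum is zero.
  have hpow1 : τ * τ ^ (e - 1).toNat * laguerreSum ν j k m = τ ^ e.toNat * laguerreSum ν j k m := by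
    rcases lt_or_ge (e - 1) 0 with h | h
    · rw [laguerreSum_eq_zero ν (by omega)]; simp
    · rw [← pow_succ', show (e - 1).toNat + 1 = e.toNat by omega]
  have hpow2 : ∀ M : ℝ, (e - 2 < 0 → M = 0) →
      τ ^ 2 * τ ^ (e - 2).toNat * M = τ ^ e.toNat * M := by
    intro M hM
    rcases lt_or_ge (e - 2) 0 with h | h
    · rw [hM h]; simp
    · rw [← pow_add, show 2 + (e - 2).toNat = e.toNat by omega]
  have hprev : laguerreLinearization τ ν k m (j - 1)
      = τ ^ e.toNat * (m ! * k ! / Real.Gamma (j + ν + 1))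
        * ((j + ν) * laguerreSum ν (j - 1) k m) := by
    rw [laguerreLinearization, show (m : ℤ) + k - (j - 1) = e by omega]
    rcases hj.eq_or_lt with rfl | hj0
    · have : laguerreSum ν (0 - 1) k m = 0 :=
        Finset.sum_eq_zero fun s _ => laguerreTerm_eq_zero ν (by omega)
      rw [this]; simp
    · have h2 := gamma_add_succ hν (n := j - 1) (by omega)
      have h3 := gamma_add_pos hν (n := j - 1) (by omega)
      have h4 : (1 : ℝ) ≤ j := by exact_mod_cast hj0
      rw [sub_add_cancel] at h2
      rw [h2]
      push_cast at h3 ⊢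
      have : (j : ℝ) + ν ≠ 0 := by linarith
      rw [show (j : ℝ) - 1 + ν + 1 = j + ν by ring] at *
      field_simp
  have hnext : τ ^ 2 * (((j + 1 : ℤ) : ℝ) * (((j + 1 : ℤ) : ℝ) + ν))
        * laguerreLinearization τ ν k m (j + 1)
      = τ ^ e.toNat * (m ! * k ! / Real.Gamma (j + ν + 1))
        * ((j + 1) * laguerreSum ν (j + 1) k m) := by
    rw [laguerreLinearization, gamma_add_succ hν hj, show (m : ℤ) + k - (j + 1) = e - 2 by omega]
    have h1 := hpow2 (laguerreSum ν (j + 1) k m) fun h => laguerreSum_eq_zero ν (by omega)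
    have hq : (j : ℝ) + ν + 1 ≠ 0 := by linarith
    push_cast
    rw [show (j : ℝ) + 1 + ν = j + ν + 1 by ring]
    field_simp
    linear_combination h1
  have hlow : τ ^ 2 * (m * (m + ν)) * laguerreLinearization τ ν k (m - 1) j
      = τ ^ e.toNat * (m ! * k ! / Real.Gamma (j + ν + 1))
        * ((m + ν) * laguerreSum ν j k (m - 1)) := by
    rcases m with _ | m
    · have : laguerreSum ν j k ((0 : ℕ) - 1) = 0 :=
        Finset.sum_eq_zero fun s _ => laguerreTerm_eq_zero ν (by push_cast; omega)
      rw [this]; simp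
    · rw [laguerreLinearization, Nat.add_sub_cancel, show (m : ℤ) + k - j = e - 2 by
        push_cast at he; omega, show ((m + 1 : ℕ) : ℤ) - 1 = m by push_cast; ring,
        Nat.factorial_succ]
      have h1 := hpow2 (laguerreSum ν j k m) fun h =>
        laguerreSum_eq_zero ν (by push_cast at he; omega)
      push_cast
      field_simp
      linear_combination (m + 1 + ν) * h1
  rw [hprev, hnext, hlow]
  unfold laguerreLinearization
  have hc := laguerreSum_contiguous hν j k m (by omega)
  rw [show ((m + 1 : ℕ) : ℤ) + k - j = e by push_cast; omega,
    show (m : ℤ) + k - j = e - 1 by omega, Nat.factorial_succ]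
  push_cast at hc ⊢
  linear_combination (τ ^ e.toNat * (m ! * k ! / Real.Gamma (j + ν + 1))) * hc
    - (2 * (j : ℝ) - 2 * m) * (m ! * k ! / Real.Gamma (j + ν + 1)) * hpow1

lemma mulPowCoeff_laguerre (τ : ℝ) {ν : ℝ} (hν : -1 < ν) (p j k : ℕ) :
    mulPowCoeff (planarLaguerreSeq τ ν) p j k
      = ∑ l ∈ Finset.range (p + 1),
          laguerreMonomial τ ν p l * laguerreLinearization τ ν k l j := by
  have h1 : ∀ n : ℤ, coord (planarLaguerreSeq τ ν) (X ^ p) n = laguerreMonomial τ ν p n := fun n =>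
    coord_X_pow_eq (planarLaguerre_hasRecurrence τ ν) (planarLaguerre_zero τ ν) _
      (laguerreMonomial_zero hν τ) (fun p j => laguerreMonomial_succ hν τ p j) p n
  have h2 : ∀ m : ℕ, coord (planarLaguerreSeq τ ν)
      (planarLaguerreSeq τ ν m * planarLaguerreSeq τ ν k) j = laguerreLinearization τ ν k m j :=
    fun m => coord_mul_eq (planarLaguerre_hasRecurrence τ ν) (planarLaguerre_zero τ ν) k _
      (laguerreLinearization_zero hν τ k)
      (fun m j => by simp [laguerreLinearization_succ hν]) m j
  rw [mulPowCoeff_eq_sum]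
  · simp only [h1, h2]
  · intro n hn
    rw [h1, laguerreMonomial, powFact_of_neg _ (by omega)]
    simp

/-- The expansion coefficients for the planar Laguerre polynomials. -/
theorem mulPowCoeff_planarLaguerre (τ : ℝ) {ν : ℝ} (hν : -1 < ν) (p j k : ℕ)
    (h : |(j : ℤ) - k| ≤ p) :
    mulPowCoeff (planarLaguerreSeq τ ν) p j k
      = τ ^ ((p : ℤ) + k - j)
        * ∑ l ∈ Finset.range (p + 1),
            (p ! : ℝ) / (p - l)! * (Real.Gamma (p + ν + 1) / Real.Gamma (l + ν + 1))
              * (k ! / Real.Gamma (j + ν + 1))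
              * ∑ s ∈ Finset.range (j + k + l + 1),
                  Real.Gamma (s + ν + 1) * 2 ^ ((j : ℤ) + k + l - 2 * s)
                    * invFact ((s : ℤ) - j) * invFact ((s : ℤ) - k) * invFact ((s : ℤ) - l)
                    * invFact ((j : ℤ) + k + l - 2 * s) := by
  rw [mulPowCoeff_laguerre τ hν, Finset.mul_sum]
  refine Finset.sum_congr rfl fun l hl => ?_
  rw [abs_le] at h
  have hl : l ≤ p := by have := Finset.mem_range.1 hl; omega
  have hs : ∑ s ∈ Finset.range (j + k + l + 1),
      Real.Gamma (s + ν + 1) * 2 ^ ((j : ℤ) + k + l - 2 * s)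
        * invFact ((s : ℤ) - j) * invFact ((s : ℤ) - k) * invFact ((s : ℤ) - l)
        * invFact ((j : ℤ) + k + l - 2 * s) = laguerreSum ν j k l :=
    (laguerreSum_eq ν j k l (N := j + k + l + 1) (by push_cast; omega)).symm
  rw [hs, laguerreLinearization]
  rcases lt_or_ge ((l : ℤ) + k - j) 0 with h0 | h0
  · rw [laguerreSum_eq_zero ν (by omega)]; simp
  obtain ⟨i, rfl⟩ := Nat.exists_eq_add_of_le' hl
  obtain ⟨r, hr⟩ := Int.eq_ofNat_of_zero_le h0
  rw [laguerreMonomial, show ((i + l : ℕ) : ℤ) + k - j = ((i + r : ℕ) : ℤ) by push_cast; omega,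
    zpow_natCast, hr, Int.toNat_natCast, show ((i + l : ℕ) : ℤ) - l = i by push_cast; ring,
    powFact, invFact_natCast, invFact_natCast, Nat.add_sub_cancel, Int.toNat_natCast, pow_add,
    Int.cast_natCast, Int.cast_natCast]
  have : (l ! : ℝ) ≠ 0 := by positivity
  field_simp

/-- Since l ≤ p < |j - k|, the triple j, k, l violates the triangle inequality. -/
theorem mulPowCoeff_planarLaguerre_eq_zero (τ : ℝ) {ν : ℝ} (hν : -1 < ν) (p j k : ℕ)
    (h : ¬ |(j : ℤ) - k| ≤ p) : mulPowCoeff (planarLaguerreSeq τ ν) p j k = 0 := by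
  rw [mulPowCoeff_laguerre τ hν]
  refine Finset.sum_eq_zero fun l hl => ?_
  rw [abs_le] at h
  have hl : l ≤ p := by have := Finset.mem_range.1 hl; omega
  rw [laguerreLinearization, laguerreSum_eq_zero ν (by omega)]
  simp

/-! ### Gegenbauer polynomials -/

/-- The coefficient of `p_n` in `z^p` for the planar Gegenbauer polynomials. -/
def gegenbauerMonomial (τ a : ℝ) (p : ℕ) (n : ℤ) : ℝ :=
  if Even ((p : ℤ) - n) then
    p ! / 2 ^ p * (n + a + 1) * powPochFact 2 (a + 1) n * powFact τ ((p - n) / 2)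
      / intPoch (a + 1) (n + (p - n) / 2 + 1)
  else 0

/-- The factor `m! / (2^m (c)_m)` that makes `C_m^{(c)}` monic. -/
def gegenbauerNorm (c : ℝ) (m : ℕ) : ℝ := m ! / (2 ^ m * poch c m)

/-- The factor `2^j (c)_j (j + c) / (2c)_j` of the linearization coefficients. -/
def gegenbauerWeight (c : ℝ) (j : ℤ) : ℝ :=
  2 ^ j.toNat * intPoch c j * (j + c) / intPoch (2 * c) j

/-- The coefficient of `p_j` in `p_m p_k` for the planar Gegenbauer polynomials. -/
def gegenbauerLinearization (τ a : ℝ) (k m : ℕ) (j : ℤ) : ℝ :=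
  if Even ((m : ℤ) + k - j) then
    gegenbauerNorm (a + 1) m * gegenbauerNorm (a + 1) k * gegenbauerWeight (a + 1) j
      * (powPochFact τ (a + 1) ((m + k - j) / 2) * powPochFact 1 (a + 1) ((m + j - k) / 2)
        * powPochFact 1 (a + 1) ((j + k - m) / 2))
      * (intPoch (2 * (a + 1)) ((m + k + j) / 2) / intPoch (a + 1) ((m + k + j) / 2 + 1))
  else 0

lemma gegenbauerMonomial_of_neg (τ a : ℝ) (p : ℕ) {n : ℤ} (hn : n < 0) :
    gegenbauerMonomial τ a p n = 0 := by
  unfold gegenbauerMonomial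
  rw [powPochFact_of_neg _ _ hn]
  simp

lemma gegenbauerMonomial_eq (τ a : ℝ) (p : ℕ) (n l : ℤ) (h : n + 2 * l = p) :
    gegenbauerMonomial τ a p n
      = p ! / 2 ^ p * (n + a + 1) * powPochFact 2 (a + 1) n * powFact τ l
        / intPoch (a + 1) (n + l + 1) := by
  rw [gegenbauerMonomial, if_pos ⟨l, by omega⟩, show ((p : ℤ) - n) / 2 = l by omega]

lemma gegenbauerMonomial_zero {a : ℝ} (ha : -1 < a) (τ : ℝ) (n : ℤ) :
    gegenbauerMonomial τ a 0 n = if n = 0 then 1 else 0 := by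
  split_ifs with h
  · subst h
    rw [gegenbauerMonomial_eq τ a 0 0 0 (by simp), powPochFact_zero, powFact_zero,
      intPoch_add_one _ (by omega)]
    have h0 : intPoch (a + 1) 0 = 1 := by simp [intPoch, poch_zero]
    rw [add_zero, h0]
    have : a + 1 ≠ 0 := by linarith
    simp [this]
  · rcases lt_or_gt_of_ne h with h | h
    · exact gegenbauerMonomial_of_neg _ _ _ h
    · unfold gegenbauerMonomial
      split_ifs
      · rw [powFact_of_neg _ (by push_cast; omega)]; simp
      · rfl

/-- With p + 1 = n + 2l, clearing common factors leaves (n + 2l)(n + a + 1) = n(n + l + a + 1) + l(n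
+ 2a + 2). -/
lemma gegenbauerMonomial_succ {a : ℝ} (ha : -1 < a) (τ : ℝ) (p : ℕ) (n : ℤ) :
    gegenbauerMonomial τ a (p + 1) n
      = gegenbauerMonomial τ a p (n - 1)
        + τ * (((n + 1 : ℤ) : ℝ) * (((n + 1 : ℤ) : ℝ) + 2 * a + 1))
            / (4 * ((((n + 1 : ℤ) : ℝ) + a) * (((n + 1 : ℤ) : ℝ) + a + 1)))
          * gegenbauerMonomial τ a p (n + 1) := by
  rcases lt_or_ge n 0 with hn | hn
  · rw [gegenbauerMonomial_of_neg _ _ _ hn, gegenbauerMonomial_of_neg (n := n - 1) _ _ _ (by omega)]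
    rcases eq_or_ne (n + 1) 0 with h | h
    · rw [h]; simp
    · rw [gegenbauerMonomial_of_neg (n := n + 1) _ _ _ (by omega)]; simp
  by_cases h : Even (((p + 1 : ℕ) : ℤ) - n)
  · obtain ⟨l, hl⟩ := h
    rw [gegenbauerMonomial_eq τ a (p + 1) n l (by omega),
      gegenbauerMonomial_eq τ a p (n - 1) l (by push_cast at hl; omega),
      gegenbauerMonomial_eq τ a p (n + 1) (l - 1) (by push_cast at hl; omega),
      show n + 1 + (l - 1) + 1 = n + l + 1 by ring, show n - 1 + l + 1 = n + l by ring]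
    have e1 := mul_powFact_sub_one τ l
    rcases lt_or_ge l 0 with hl0 | hl0
    · rw [powFact_of_neg _ hl0, powFact_of_neg (n := l - 1) _ (by omega)]; simp
    have hn' : (0 : ℝ) ≤ n := by exact_mod_cast hn
    have hl' : (0 : ℝ) ≤ l := by exact_mod_cast hl0
    have e2 := mul_powPochFact 2 (a + 1) n
    have e3 := mul_powPochFact 2 (a + 1) (n + 1)
    rw [add_sub_cancel_right] at e3
    have hp : (p : ℝ) + 1 = n + 2 * l := by
      have : ((p + 1 : ℤ) : ℝ) = ((n + 2 * l : ℤ) : ℝ) := by congr 1; push_cast at hl; omega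
      push_cast at this; exact this
    have hQ := (intPoch_pos (show 0 < a + 1 by linarith) (n + l)).ne'
    rw [intPoch_add_one _ (show 0 ≤ n + l by omega), Nat.factorial_succ]
    push_cast at e3 ⊢
    have hD : powPochFact 2 (a + 1) (n + 1)
        = 2 * (n + 1 - 1 + (a + 1)) * powPochFact 2 (a + 1) n / (n + 1) := by
      rw [eq_div_iff (by positivity)]; linear_combination e3
    have q1 : a + 1 + ((n : ℝ) + l) ≠ 0 := by linarith
    have q2 : (n : ℝ) + 1 + a ≠ 0 := by linarith
    have q3 : (n : ℝ) + 1 + a + 1 ≠ 0 := by linarith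
    have q4 : (n : ℝ) + 1 ≠ 0 := by linarith
    rw [hD, hp]
    have e2' : ((n : ℝ) - 1 + a + 1) * powPochFact 2 (a + 1) (n - 1)
        = n * powPochFact 2 (a + 1) n / 2 := by linear_combination -e2 / 2
    rw [mul_assoc ((p ! : ℝ) / 2 ^ p) ((n : ℝ) - 1 + a + 1), e2', pow_succ]
    generalize powPochFact 2 (a + 1) n = D at *
    generalize intPoch (a + 1) (n + l) = Q at *
    field_simp
    linear_combination (-(4 * D * (n + 2 * a + 2) * (n + 1 + a))) * e1
  · have hodd : ∀ (q : ℕ) (i : ℤ), ¬ Even ((q : ℤ) - i) → gegenbauerMonomial τ a q i = 0 :=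
      fun q i hq => if_neg hq
    rw [hodd _ _ h, hodd, hodd]
    · simp
    · intro h'; apply h; obtain ⟨l, hl⟩ := h'; exact ⟨l + 1, by push_cast; omega⟩
    · intro h'; apply h; obtain ⟨l, hl⟩ := h'; exact ⟨l, by push_cast; omega⟩

lemma gegenbauerLinearization_eq (τ a : ℝ) (k m : ℕ) (j α β γ : ℤ) (hm : α + β = m)
    (hk : α + γ = k) (hj : β + γ = j) :
    gegenbauerLinearization τ a k m j
      = gegenbauerNorm (a + 1) m * gegenbauerNorm (a + 1) k * gegenbauerWeight (a + 1) j
        * (powPochFact τ (a + 1) α * powPochFact 1 (a + 1) β * powPochFact 1 (a + 1) γ)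
        * (intPoch (2 * (a + 1)) (α + β + γ) / intPoch (a + 1) (α + β + γ + 1)) := by
  rw [gegenbauerLinearization, if_pos ⟨α, by omega⟩, show ((m : ℤ) + k - j) / 2 = α by omega,
    show ((m : ℤ) + j - k) / 2 = β by omega, show (j + k - (m : ℤ)) / 2 = γ by omega,
    show ((m : ℤ) + k + j) / 2 = α + β + γ by omega]

/-- The hypothesis excludes the triples with even sum that satisfy the triangle inequality; for all
others the parity fails or one reciprocal factorial is 0. -/
lemma gegenbauerLinearization_eq_zero (τ a : ℝ) (k m : ℕ) (j : ℤ)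
    (h : ∀ α β γ : ℤ, 0 ≤ α → 0 ≤ β → 0 ≤ γ → α + β = m → α + γ = k → β + γ = j → False) :
    gegenbauerLinearization τ a k m j = 0 := by
  by_cases hE : Even ((m : ℤ) + k - j)
  · obtain ⟨α, hα⟩ := hE
    rw [gegenbauerLinearization_eq τ a k m j α (m - α) (k - α) (by omega) (by omega) (by omega)]
    rcases lt_or_ge α 0 with h1 | h1
    · rw [powPochFact_of_neg _ _ h1]; simp
    rcases lt_or_ge ((m : ℤ) - α) 0 with h2 | h2
    · rw [powPochFact_of_neg _ _ h2]; simp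
    rcases lt_or_ge ((k : ℤ) - α) 0 with h3 | h3
    · rw [powPochFact_of_neg _ _ h3]; simp
    exact (h α _ _ h1 h2 h3 (by omega) (by omega) (by omega)).elim
  · exact if_neg hE

lemma gegenbauerNorm_succ {c : ℝ} (hc : 0 < c) (m : ℕ) :
    gegenbauerNorm c (m + 1) = gegenbauerNorm c m * ((m + 1) / (2 * (c + m))) := by
  have := (poch_pos hc m).ne'
  have : c + (m : ℝ) ≠ 0 := by positivity
  rw [gegenbauerNorm, gegenbauerNorm, poch_succ, Nat.factorial_succ, pow_succ]
  push_cast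
  field_simp

lemma gegenbauerWeight_succ {c : ℝ} (hc : 0 < c) {j : ℤ} (hj : 0 ≤ j) :
    gegenbauerWeight c (j + 1) * (2 * c + j) = gegenbauerWeight c j * (2 * (j + 1 + c)) := by
  have h1 := (intPoch_pos hc j).ne'
  have h2 := (intPoch_pos (show 0 < 2 * c by positivity) j).ne'
  have hj' : (0 : ℝ) ≤ j := by exact_mod_cast hj
  have h3 : 2 * c + (j : ℝ) ≠ 0 := by positivity
  rw [gegenbauerWeight, gegenbauerWeight, intPoch_add_one _ hj, intPoch_add_one _ hj,
    show (j + 1).toNat = j.toNat + 1 by omega, pow_succ]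
  push_cast
  field_simp
  ring

lemma gegenbauerLinearization_zero {a : ℝ} (ha : -1 < a) (τ : ℝ) (k : ℕ) (j : ℤ) :
    gegenbauerLinearization τ a k 0 j = if j = k then 1 else 0 := by
  split_ifs with h
  · subst h
    have hc : 0 < a + 1 := by linarith
    have h1 := (poch_pos hc k).ne'
    have h2 := (poch_pos (show 0 < 2 * (a + 1) by positivity) k).ne'
    have h3 : a + 1 + (k : ℝ) ≠ 0 := by positivity
    rw [gegenbauerLinearization_eq τ a k 0 k 0 0 k (by simp) (by simp) (by simp), powPochFact_zero,
      powPochFact_zero, powPochFact, gegenbauerWeight, gegenbauerNorm, gegenbauerNorm, poch_zero,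
      zero_add, zero_add, intPoch_add_one _ (by omega)]
    simp only [intPoch_natCast, invFact_natCast, Int.toNat_natCast, Int.cast_natCast]
    generalize poch (2 * (a + 1)) k = P at *
    generalize poch (a + 1) k = Q at *
    simp only [Nat.factorial_zero, Nat.cast_one, pow_zero, mul_one, div_one, one_mul, one_pow]
    field_simp
    ring
  · exact gegenbauerLinearization_eq_zero _ _ _ _ _ fun α β γ h1 h2 h3 h4 h5 h6 => h (by
      push_cast at h4; omega)

/-- The rational identity behind the recurrence of the linearization coefficients. -/
lemma gegenbauer_contiguous {c : ℝ} (hc : 0 < c) {α β γ : ℤ} (hα : 0 ≤ α) (hβ : 0 ≤ β)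
    (hγ : -1 ≤ γ) (hαβ : 1 ≤ α + β) (hβγ : 0 ≤ β + γ)
    (hαγ : 0 ≤ α + γ) {A A' B B' G G' : ℝ}
    (hA : α * A = (α - 1 + c) * A') (hA0 : α = 0 → A' = 0)
    (hB : β * B = (β - 1 + c) * B') (hB0 : β = 0 → B' = 0)
    (hG : (γ + 1) * G' = (γ + c) * G) (hG0 : γ = -1 → G = 0) :
    (α + β) / (2 * (c + (α + β - 1))) * (A * B * G)
      = (2 * c + (β + γ) - 1) / (2 * (β + γ + c))
          * ((c + (α + β + γ)) / (2 * c + (α + β + γ) - 1)) * (A * B' * G)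
        + (β + γ + 1) / (2 * (β + γ + c)) * (A' * B * G')
        - (α + β - 1 + 2 * c - 1) / (2 * (α + β - 1 + c))
          * ((c + (α + β + γ)) / (2 * c + (α + β + γ) - 1)) * (A' * B' * G') := by
  have hα' : (0 : ℝ) ≤ α := by exact_mod_cast hα
  have hβ' : (0 : ℝ) ≤ β := by exact_mod_cast hβ
  have hαβ' : (1 : ℝ) ≤ α + β := by exact_mod_cast hαβ
  have hβγ' : (0 : ℝ) ≤ β + γ := by exact_mod_cast hβγ
  have q1 : c + ((α : ℝ) + β - 1) ≠ 0 := by linarith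
  have q1' : (α : ℝ) + β - 1 + c ≠ 0 := by linarith
  have q2 : (β : ℝ) + γ + c ≠ 0 := by linarith
  have q3 : 2 * c + ((α : ℝ) + β + γ) - 1 ≠ 0 := by
    have : (1 : ℝ) ≤ α + β + γ := by exact_mod_cast (show 1 ≤ α + β + γ by omega)
    linarith
  -- At γ = -1 the relation between G and G' is void. There G = 0 and the last two terms cancel each
  -- other, with β ≥ 1 because β + γ ≥ 0.
  rcases hγ.eq_or_lt with hγ | hγ
  · have hγ' : (γ : ℝ) = -1 := by rw [← hγ]; simp
    have hβ1 : (1 : ℝ) ≤ β := by exact_mod_cast (show 1 ≤ β by omega)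
    have hB1 : B = (β - 1 + c) * B' / β := by
      rw [eq_div_iff (by linarith)]; linear_combination hB
    rw [hG0 hγ.symm, hB1]
    rw [hγ'] at q2 q3 ⊢
    have q4 : (β : ℝ) ≠ 0 := by linarith
    field_simp
    ring
  have hγ0 : (0 : ℝ) ≤ γ := by exact_mod_cast (show 0 ≤ γ by omega)
  have hG1 : G' = (γ + c) * G / (γ + 1) := by
    rw [eq_div_iff (by linarith)]; linear_combination hG
  have q4 : (γ : ℝ) + 1 ≠ 0 := by linarith
  -- At α = 0 the value A is unconstrained, but A' = 0 removes the last two terms. The case β = 0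
  -- below is analogous, with B' = 0.
  rcases hα.eq_or_lt with hα | hα
  · have hβ1 : (1 : ℝ) ≤ β := by exact_mod_cast (show 1 ≤ β by omega)
    have hB1 : B = (β - 1 + c) * B' / β := by
      rw [eq_div_iff (by linarith)]; linear_combination hB
    have q5 : (β : ℝ) ≠ 0 := by linarith
    have hα2 : (α : ℝ) = 0 := by rw [← hα]; simp
    rw [hA0 hα.symm, hB1]
    rw [hα2] at q1 q1' q3 ⊢
    field_simp
    ring
  have hα1 : (1 : ℝ) ≤ α := by exact_mod_cast hα
  have hA1 : A = (α - 1 + c) * A' / α := by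
    rw [eq_div_iff (by linarith)]; linear_combination hA
  have q6 : (α : ℝ) ≠ 0 := by linarith
  rcases hβ.eq_or_lt with hβ | hβ
  · have hβ2 : (β : ℝ) = 0 := by rw [← hβ]; simp
    rw [hB0 hβ.symm, hA1, hG1]
    rw [hβ2] at q1 q1' q2 q3 ⊢
    field_simp
    ring
  have hβ1 : (1 : ℝ) ≤ β := by exact_mod_cast hβ
  have hB1 : B = (β - 1 + c) * B' / β := by
    rw [eq_div_iff (by linarith)]; linear_combination hB
  have q5 : (β : ℝ) ≠ 0 := by linarith
  rw [hA1, hB1, hG1]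
  field_simp
  ring

-- In the coordinates α, β, γ of m + 1, k, j the four terms are one quantity V times rational
-- factors and shifted products, so the claim reduces to `gegenbauer_contiguous`.
set_option maxHeartbeats 400000 in
lemma gegenbauerLinearization_succ {a : ℝ} (ha : -1 < a) (τ : ℝ) (k m : ℕ) (j : ℤ) :
    gegenbauerLinearization τ a k (m + 1) j
      = gegenbauerLinearization τ a k m (j - 1)
        + τ * (((j + 1 : ℤ) : ℝ) * (((j + 1 : ℤ) : ℝ) + 2 * a + 1))
            / (4 * ((((j + 1 : ℤ) : ℝ) + a) * (((j + 1 : ℤ) : ℝ) + a + 1)))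
          * gegenbauerLinearization τ a k m (j + 1)
        - τ * (m * (m + 2 * a + 1)) / (4 * ((m + a) * (m + a + 1)))
          * gegenbauerLinearization τ a k (m - 1) j := by
  have hneg : ∀ (q : ℕ) (i : ℤ), i < 0 → gegenbauerLinearization τ a k q i = 0 := fun q i hi =>
    gegenbauerLinearization_eq_zero _ _ _ _ _ fun α β γ h1 h2 h3 h4 h5 h6 => by omega
  rcases lt_or_ge j 0 with hj | hj
  · rw [hneg _ _ hj, hneg _ _ hj, hneg _ (j - 1) (by omega)]
    rcases eq_or_ne (j + 1) 0 with h | h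
    · rw [h]; simp
    · rw [hneg _ (j + 1) (by omega)]; simp
  by_cases hE : Even (((m + 1 : ℕ) : ℤ) + k - j)
  · obtain ⟨α, hα⟩ := hE
    obtain ⟨β, hβ⟩ : ∃ β : ℤ, α + β = m + 1 := ⟨m + 1 - α, by omega⟩
    obtain ⟨γ, hγ⟩ : ∃ γ : ℤ, α + γ = k := ⟨k - α, by omega⟩
    have hβγ : β + γ = j := by push_cast at hα; omega
    obtain ⟨c, hc⟩ : ∃ c, c = a + 1 := ⟨_, rfl⟩
    have hc0 : 0 < c := by linarith
    have hj' : (0 : ℝ) ≤ j := by exact_mod_cast hj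
    have hm' : (0 : ℝ) ≤ m := by positivity
    -- the common value of all four terms, up to rational factors
    obtain ⟨V, hV⟩ : ∃ V, V = gegenbauerNorm c m * gegenbauerNorm c k * gegenbauerWeight c j
      * (intPoch (2 * c) (α + β + γ) / intPoch c (α + β + γ + 1)) := ⟨_, rfl⟩
    obtain ⟨S, hS⟩ : ∃ S : ℤ, S = α + β + γ := ⟨_, rfl⟩
    have hS1 : 1 ≤ S := by omega
    have hS' : (1 : ℝ) ≤ S := by exact_mod_cast hS1
    have hW : intPoch (2 * c) (S - 1) / intPoch c (S - 1 + 1)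
        = intPoch (2 * c) S / intPoch c (S + 1) * ((c + S) / (2 * c + S - 1)) := by
      have h1 := intPoch_add_one (2 * c) (show 0 ≤ S - 1 by omega)
      have h2 := intPoch_add_one c (show 0 ≤ S by omega)
      have h3 := (intPoch_pos hc0 S).ne'
      rw [sub_add_cancel] at h1 ⊢
      rw [h1, h2]
      push_cast
      have : c + (S : ℝ) ≠ 0 := by linarith
      have : 2 * c + (S : ℝ) - 1 ≠ 0 := by linarith
      field_simp
      ring
    have t1 : gegenbauerLinearization τ a k (m + 1) j
        = V * ((m + 1) / (2 * (c + m))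
          * (powPochFact τ c α * powPochFact 1 c β * powPochFact 1 c γ)) := by
      rw [gegenbauerLinearization_eq τ a k (m + 1) j α β γ (by push_cast; omega) hγ hβγ, ← hc,
        gegenbauerNorm_succ hc0, hV]
      ring
    have t2 : gegenbauerLinearization τ a k m (j - 1)
        = V * ((2 * c + j - 1) / (2 * (j + c)) * ((c + S) / (2 * c + S - 1))
          * (powPochFact τ c α * powPochFact 1 c (β - 1) * powPochFact 1 c γ)) := by
      rw [gegenbauerLinearization_eq τ a k m (j - 1) α (β - 1) γ (by omega) hγ (by omega), ← hc,
        hV, show α + (β - 1) + γ = S - 1 by omega, hW, ← hS]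
      -- At j = 0 the weight at j - 1 is a truncated value, but β + γ = 0 forces β - 1 < 0 or γ < 0,
      -- so both sides vanish.
      rcases hj.eq_or_lt with rfl | hj0
      · rcases lt_or_ge (β - 1) 0 with h | h
        · rw [powPochFact_of_neg _ _ h]; simp
        · rw [powPochFact_of_neg (n := γ) _ _ (by omega)]; simp
      · have h1 := gegenbauerWeight_succ hc0 (show 0 ≤ j - 1 by omega)
        rw [sub_add_cancel] at h1
        push_cast at h1
        have h2 : gegenbauerWeight c (j - 1)
            = gegenbauerWeight c j * ((2 * c + j - 1) / (2 * (j + c))) := by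
          have : (j : ℝ) + c ≠ 0 := by linarith
          field_simp
          linear_combination -h1
        rw [h2]
        ring
    have t3 : τ * (((j + 1 : ℤ) : ℝ) * (((j + 1 : ℤ) : ℝ) + 2 * a + 1))
            / (4 * ((((j + 1 : ℤ) : ℝ) + a) * (((j + 1 : ℤ) : ℝ) + a + 1)))
          * gegenbauerLinearization τ a k m (j + 1)
        = V * ((j + 1) / (2 * (j + c))
          * (τ * powPochFact τ c (α - 1) * powPochFact 1 c β * powPochFact 1 c (γ + 1))) := by
      rw [gegenbauerLinearization_eq τ a k m (j + 1) (α - 1) β (γ + 1) (by omega) (by omega)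
        (by omega), ← hc, hV, show α - 1 + β + (γ + 1) = S by omega, ← hS]
      have h1 := gegenbauerWeight_succ hc0 hj
      have h2 : gegenbauerWeight c (j + 1)
          = gegenbauerWeight c j * (2 * (j + 1 + c)) / (2 * c + j) := by
        rw [eq_div_iff (by linarith)]; exact h1
      have q1 : 2 * c + (j : ℝ) ≠ 0 := by linarith
      have q2 : (j : ℝ) + c ≠ 0 := by linarith
      have q3 : (j : ℝ) + 1 + c ≠ 0 := by linarith
      have h3 : τ * (((j + 1 : ℤ) : ℝ) * (((j + 1 : ℤ) : ℝ) + 2 * a + 1))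
            / (4 * ((((j + 1 : ℤ) : ℝ) + a) * (((j + 1 : ℤ) : ℝ) + a + 1)))
          * gegenbauerWeight c (j + 1) = τ * gegenbauerWeight c j * ((j + 1) / (2 * (j + c))) := by
        rw [h2, show a = c - 1 by linarith]
        push_cast
        rw [show (j : ℝ) + 1 + 2 * (c - 1) + 1 = 2 * c + j by ring,
          show (j : ℝ) + 1 + (c - 1) = j + c by ring, show (j : ℝ) + c + 1 = j + 1 + c by ring]
        generalize gegenbauerWeight c j = w
        field_simp
        ring
      linear_combination (gegenbauerNorm c m * gegenbauerNorm c k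
        * (powPochFact τ c (α - 1) * powPochFact 1 c β * powPochFact 1 c (γ + 1))
        * (intPoch (2 * c) S / intPoch c (S + 1))) * h3
    have t4 : τ * (m * (m + 2 * a + 1)) / (4 * ((m + a) * (m + a + 1)))
          * gegenbauerLinearization τ a k (m - 1) j
        = V * ((m + 2 * c - 1) / (2 * (m + c)) * ((c + S) / (2 * c + S - 1))
          * (τ * powPochFact τ c (α - 1) * powPochFact 1 c (β - 1) * powPochFact 1 c (γ + 1))) := by
      rcases m with _ | m
      · rcases lt_or_ge (β - 1) 0 with h | h
        · rw [powPochFact_of_neg _ _ h]; simp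
        · rw [powPochFact_of_neg (n := α - 1) _ _ (by push_cast at hβ; omega)]; simp
      · rw [Nat.add_sub_cancel, gegenbauerLinearization_eq τ a k m j (α - 1) (β - 1) (γ + 1)
          (by push_cast at hβ; omega) (by omega) (by omega), ← hc, hV,
          show α - 1 + (β - 1) + (γ + 1) = S - 1 by omega, hW, ← hS, gegenbauerNorm_succ hc0 m]
        have hm0 : (0 : ℝ) ≤ m := by positivity
        have q1 : c + (m : ℝ) ≠ 0 := by linarith
        have q2 : (m : ℝ) + 1 + c ≠ 0 := by linarith
        have h3 : τ * (((m + 1 : ℕ) : ℝ) * (((m + 1 : ℕ) : ℝ) + 2 * a + 1))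
              / (4 * ((((m + 1 : ℕ) : ℝ) + a) * (((m + 1 : ℕ) : ℝ) + a + 1)))
            = τ * ((m + 1) / (2 * (c + m)))
              * ((((m + 1 : ℕ) : ℝ) + 2 * c - 1) / (2 * (((m + 1 : ℕ) : ℝ) + c))) := by
          rw [show a = c - 1 by linarith]
          push_cast
          rw [show (m : ℝ) + 1 + 2 * (c - 1) + 1 = m + 2 * c by ring,
            show (m : ℝ) + 1 + (c - 1) = c + m by ring, show c + (m : ℝ) + 1 = m + 1 + c by ring,
            show (m : ℝ) + 1 + 2 * c - 1 = m + 2 * c by ring]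
          field_simp
          ring
        rw [h3]
        ring
    rw [t1, t2, t3, t4, ← mul_add, ← mul_sub]
    congr 1
    have hm2 : (m : ℝ) = α + β - 1 := by
      have : ((m : ℤ) : ℝ) = ((α + β - 1 : ℤ) : ℝ) := by congr 1; omega
      push_cast at this; exact this
    rcases lt_or_ge α 0 with h1 | h1
    · rw [powPochFact_of_neg _ _ h1, powPochFact_of_neg (n := α - 1) _ _ (by omega)]; simp
    rcases lt_or_ge β 0 with h2 | h2
    · rw [powPochFact_of_neg _ _ h2, powPochFact_of_neg (n := β - 1) _ _ (by omega)]; simp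
    -- The bound is -1 and not 0, because for γ = -1 the factors at γ + 1 = 0 still contribute.
    rcases lt_or_ge γ (-1) with h3 | h3
    · rw [powPochFact_of_neg (n := γ) _ _ (by omega),
        powPochFact_of_neg (n := γ + 1) _ _ (by omega)]; simp
    have hA := mul_powPochFact τ c α
    have hB := mul_powPochFact 1 c β
    have hG := mul_powPochFact 1 c (γ + 1)
    rw [add_sub_cancel_right] at hG
    push_cast at hG
    have key := gegenbauer_contiguous hc0 h1 h2 h3 (by omega) (by omega) (by omega)
      (A := powPochFact τ c α) (A' := τ * powPochFact τ c (α - 1))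
      (B := powPochFact 1 c β) (B' := powPochFact 1 c (β - 1))
      (G := powPochFact 1 c γ) (G' := powPochFact 1 c (γ + 1))
      (by linear_combination hA)
      (fun h => by rw [powPochFact_of_neg _ _ (by omega), mul_zero])
      (by linear_combination hB) (fun h => powPochFact_of_neg _ _ (by omega))
      (by linear_combination hG) (fun h => powPochFact_of_neg _ _ (by omega))
    rw [← hβγ, hS, hm2]
    push_cast
    rw [sub_add_cancel]
    exact key
  · have hodd : ∀ (q : ℕ) (i : ℤ), ¬ Even ((q : ℤ) + k - i) →
        gegenbauerLinearization τ a k q i = 0 := fun q i hq => if_neg hq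
    have hlast : (m : ℝ) * gegenbauerLinearization τ a k (m - 1) j = 0 := by
      rcases m with _ | m
      · simp
      · rw [hodd _ j, mul_zero]
        intro h'; apply hE; obtain ⟨l, hl⟩ := h'; exact ⟨l + 1, by push_cast at *; omega⟩
    rw [hodd _ _ hE, hodd _ (j - 1), hodd _ (j + 1)]
    · linear_combination (τ * (m + 2 * a + 1) / (4 * ((m + a) * (m + a + 1)))) * hlast
    · intro h'; apply hE; obtain ⟨l, hl⟩ := h'; exact ⟨l + 1, by push_cast; omega⟩
    · intro h'; apply hE; obtain ⟨l, hl⟩ := h'; exact ⟨l, by push_cast; omega⟩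

lemma mulPowCoeff_gegenbauer (τ a : ℝ) (hτ : 0 ≤ τ) (ha : -1 < a) (p j k : ℕ) :
    mulPowCoeff (planarGegenbauerSeq τ a hτ ha) p j k
      = ∑ l ∈ Finset.range (p / 2 + 1),
          gegenbauerMonomial τ a p ((p - 2 * l : ℕ) : ℤ)
            * gegenbauerLinearization τ a k (p - 2 * l) j := by
  have hrec := planarGegenbauer_hasRecurrence τ a hτ ha
  have h1 : ∀ n : ℤ, coord (planarGegenbauerSeq τ a hτ ha) (X ^ p) n
      = gegenbauerMonomial τ a p n := fun n =>
    coord_X_pow_eq hrec (planarGegenbauer_zero τ a) _ (gegenbauerMonomial_zero ha τ)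
      (fun p j => by rw [gegenbauerMonomial_succ ha]; simp) p n
  have h2 : ∀ m : ℕ, coord (planarGegenbauerSeq τ a hτ ha)
      (planarGegenbauerSeq τ a hτ ha m * planarGegenbauerSeq τ a hτ ha k) j
        = gegenbauerLinearization τ a k m j :=
    fun m => coord_mul_eq hrec (planarGegenbauer_zero τ a) k _
      (gegenbauerLinearization_zero ha τ k)
      (fun m j => by rw [gegenbauerLinearization_succ ha]; simp) m j
  rw [mulPowCoeff_eq_sum_step_two]
  · simp only [h1, h2]
  · intro n hn
    rw [h1, gegenbauerMonomial]
    split_ifs with h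
    · obtain ⟨l, hl⟩ := h
      rw [powFact_of_neg]
      · simp
      · by_contra h0
        exact hn l.toNat (by omega)
    · rfl

/-- The expansion coefficients for the planar Gegenbauer polynomials. -/
theorem mulPowCoeff_planarGegenbauer (τ a : ℝ) (hτ : 0 ≤ τ) (ha : -1 < a) (p j k : ℕ)
    (h : (j : ℤ) - k ∈ stepRange p) :
    mulPowCoeff (planarGegenbauerSeq τ a hτ ha) p j k
      = τ ^ (((p : ℤ) + k - j) / 2)
        * ∑ l ∈ Finset.range (p / 2 + 1),
            (k ! * 2 ^ j * poch (1 + a) j) / (2 ^ k * poch (1 + a) k)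
              * ((p ! : ℝ) / 2 ^ p)
              * (((p : ℝ) - 2 * l + a + 1) / (l ! * poch (a + 1) (p + 1 - l)))
              * (((j : ℝ) + a + 1) / (((p : ℝ) - 2 * l + k + j) / 2 + a + 1))
              * (intPoch (a + 1) (((k : ℤ) + p - 2 * l - j) / 2)
                  * intPoch (a + 1) (((j : ℤ) + p - 2 * l - k) / 2)
                  * intPoch (a + 1) (((j : ℤ) + k - p + 2 * l) / 2)
                  * intPoch (2 * a + 2) (((j : ℤ) + k + p - 2 * l) / 2))
              * (invFact (((k : ℤ) + p - 2 * l - j) / 2)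
                  * invFact (((j : ℤ) + p - 2 * l - k) / 2)
                  * invFact (((j : ℤ) + k - p + 2 * l) / 2)
                  / (intPoch (a + 1) (((j : ℤ) + k + p - 2 * l) / 2)
                      * poch (2 * a + 2) j)) := by
  obtain ⟨r, s, hr, hs, hrs, hjk⟩ := sub_mem_stepRange.1 h
  rw [mulPowCoeff_gegenbauer, Finset.mul_sum]
  refine Finset.sum_congr rfl fun l hl => ?_
  have hl : 2 * l ≤ p := by have := Finset.mem_range.1 hl; omega
  obtain ⟨m, rfl⟩ := Nat.exists_eq_add_of_le' hl
  push_cast at hrs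
  have hS0 : 0 ≤ r - l + (s - l) + (k - (r - l)) := by omega
  rw [Nat.add_sub_cancel, gegenbauerMonomial_eq τ a _ m l (by push_cast; ring),
    gegenbauerLinearization_eq τ a k m j (r - l) (s - l) (k - (r - l)) (by omega) (by omega)
      (by omega), intPoch_add_one _ hS0,
    show (((m + 2 * l : ℕ) : ℤ) + k - j) / 2 = r by push_cast; omega,
    show ((k : ℤ) + (m + 2 * l : ℕ) - 2 * l - j) / 2 = r - l by push_cast; omega,
    show ((j : ℤ) + (m + 2 * l : ℕ) - 2 * l - k) / 2 = s - l by push_cast; omega,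
    show ((j : ℤ) + k - (m + 2 * l : ℕ) + 2 * l) / 2 = k - (r - l) by push_cast; omega,
    show ((j : ℤ) + k + (m + 2 * l : ℕ) - 2 * l) / 2 = r - l + (s - l) + (k - (r - l)) by
      push_cast; omega,
    show m + 2 * l + 1 - l = m + l + 1 by omega, show (m : ℤ) + l + 1 = (m + l + 1 : ℕ) by
      push_cast; ring, intPoch_natCast]
  have hSr : ((m + 2 * l : ℕ) : ℝ) - 2 * l + k + j
      = 2 * ((r - l + (s - l) + (k - (r - l)) : ℤ) : ℝ) := by
    have : (((m + 2 * l : ℕ) : ℤ) - 2 * l + k + j : ℤ)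
      = 2 * (r - l + (s - l) + (k - (r - l))) := by push_cast; omega
    have h2 := congrArg (Int.cast : ℤ → ℝ) this
    rw [Int.cast_mul] at h2
    simpa using h2
  rw [hSr, mul_div_cancel_left₀ _ (two_ne_zero)]
  obtain ⟨S, hS⟩ : ∃ S : ℤ, S = r - l + (s - l) + (k - (r - l)) := ⟨_, rfl⟩
  rw [← hS] at hS0 ⊢
  lift r to ℕ using hr
  rcases lt_or_ge r l with h1 | h1
  · rw [powPochFact_of_neg τ _ (by omega), invFact_of_neg (n := (r : ℤ) - l) (by omega)]; simp
  obtain ⟨i, rfl⟩ := Nat.exists_eq_add_of_le' h1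
  have hc : 0 < a + 1 := by linarith
  have hSr0 : (0 : ℝ) ≤ S := by exact_mod_cast hS0
  have g1 := (poch_pos hc m).ne'
  rw [show ((i + l : ℕ) : ℤ) - l = i by push_cast; ring, show 1 + a = a + 1 by ring,
    show 2 * a + 2 = 2 * (a + 1) by ring, show (S : ℝ) + a + 1 = a + 1 + S by ring,
    gegenbauerWeight, gegenbauerNorm, gegenbauerNorm]
  simp only [powPochFact, powFact, intPoch_natCast, Int.toNat_natCast, Int.cast_natCast, one_pow,
    one_mul, zpow_natCast, pow_add τ]
  rw [invFact_natCast l, invFact_natCast m]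
  push_cast
  rw [add_sub_cancel_right, ← add_assoc (j : ℝ) a 1]
  -- The factor 2^m (a+1)_m/m! from the expansion of z^p cancels the monic normalisation of p_m in
  -- the linearization; this is the only cancellation between the two.
  have e : (2 ^ m * poch (a + 1) m * (1 / (m ! : ℝ))) * (m ! / (2 ^ m * poch (a + 1) m)) = 1 := by
    have : (m ! : ℝ) ≠ 0 := by positivity
    field_simp
  generalize 2 ^ m * poch (a + 1) m * (1 / (m ! : ℝ)) = D at *
  generalize (m ! : ℝ) / (2 ^ m * poch (a + 1) m) = D' at *
  generalize (((m + 2 * l)! : ℕ) : ℝ) / 2 ^ (m + 2 * l) = F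
  generalize intPoch (a + 1) (s - l) = B
  generalize intPoch (a + 1) (k - i) = B'
  generalize a + 1 + (S : ℝ) = T
  linear_combination (F * (m + a + 1) * (τ ^ l * (1 / l !)) / poch (a + 1) (m + l + 1)
    * (k ! / (2 ^ k * poch (a + 1) k)
      * (2 ^ j * poch (a + 1) j * (j + a + 1) / poch (2 * (a + 1)) j)
      * (τ ^ i * poch (a + 1) i * invFact i * (B * invFact (s - l)) * (B' * invFact (k - i)))
      * (intPoch (2 * (a + 1)) S / (intPoch (a + 1) S * T)))) * e

theorem mulPowCoeff_planarGegenbauer_eq_zero (τ a : ℝ) (hτ : 0 ≤ τ) (ha : -1 < a) (p j k : ℕ)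
    (h : (j : ℤ) - k ∉ stepRange p) :
    mulPowCoeff (planarGegenbauerSeq τ a hτ ha) p j k = 0 := by
  rw [mulPowCoeff_gegenbauer]
  refine Finset.sum_eq_zero fun l hl => ?_
  have hl : 2 * l ≤ p := by have := Finset.mem_range.1 hl; omega
  obtain ⟨m, rfl⟩ := Nat.exists_eq_add_of_le' hl
  rw [Nat.add_sub_cancel, gegenbauerLinearization_eq_zero, mul_zero]
  intro α β γ h1 h2 h3 h4 h5 h6
  exact h (sub_mem_stepRange.2 ⟨α + l, β + l, by omega, by omega, by push_cast; omega, by omega⟩)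

end

/-! ### The three families together -/

theorem mainTheorem6 (τ : ℝ) (hτ0 : 0 ≤ τ) (hτ1 : τ < 1) :
    -- planar Hermite polynomials
    (∀ p j k : ℕ,
      ((j : ℤ) - k ∈ stepRange p →
        mulPowCoeff (planarHermiteSeq τ hτ0) p j k
          = τ ^ (((p : ℤ) + k - j) / 2)
            * ∑ l ∈ Finset.range (p / 2 + 1),
                (p ! : ℝ) / (2 ^ l * l !) * invFact (((p : ℤ) - k + j) / 2 - l)
                  * intBinom k (((p : ℤ) + k - j) / 2 - l)) ∧
      ((j : ℤ) - k ∉ stepRange p → mulPowCoeff (planarHermiteSeq τ hτ0) p j k = 0)) ∧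
    -- planar Laguerre polynomials
    (∀ ν : ℝ, -1 < ν → ∀ p j k : ℕ,
      (|(j : ℤ) - k| ≤ p →
        mulPowCoeff (planarLaguerreSeq τ ν) p j k
          = τ ^ ((p : ℤ) + k - j)
            * ∑ l ∈ Finset.range (p + 1),
                (p ! : ℝ) / (p - l)! * (Real.Gamma (p + ν + 1) / Real.Gamma (l + ν + 1))
                  * (k ! / Real.Gamma (j + ν + 1))
                  -- the terms with `s > j + k + l` vanish
                  * ∑ s ∈ Finset.range (j + k + l + 1),
                      Real.Gamma (s + ν + 1) * 2 ^ ((j : ℤ) + k + l - 2 * s)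
                        * invFact ((s : ℤ) - j) * invFact ((s : ℤ) - k) * invFact ((s : ℤ) - l)
                        * invFact ((j : ℤ) + k + l - 2 * s)) ∧
      (¬ |(j : ℤ) - k| ≤ p → mulPowCoeff (planarLaguerreSeq τ ν) p j k = 0)) ∧
    -- planar Gegenbauer polynomials
    (∀ (a : ℝ) (ha : -1 < a), ∀ p j k : ℕ,
      ((j : ℤ) - k ∈ stepRange p →
        mulPowCoeff (planarGegenbauerSeq τ a hτ0 ha) p j k
          = τ ^ (((p : ℤ) + k - j) / 2)
            * ∑ l ∈ Finset.range (p / 2 + 1),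
                (k ! * 2 ^ j * poch (1 + a) j) / (2 ^ k * poch (1 + a) k)
                  * ((p ! : ℝ) / 2 ^ p)
                  * (((p : ℝ) - 2 * l + a + 1) / (l ! * poch (a + 1) (p + 1 - l)))
                  * (((j : ℝ) + a + 1) / (((p : ℝ) - 2 * l + k + j) / 2 + a + 1))
                  * (intPoch (a + 1) (((k : ℤ) + p - 2 * l - j) / 2)
                      * intPoch (a + 1) (((j : ℤ) + p - 2 * l - k) / 2)
                      * intPoch (a + 1) (((j : ℤ) + k - p + 2 * l) / 2)
                      * intPoch (2 * a + 2) (((j : ℤ) + k + p - 2 * l) / 2))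
                  * (invFact (((k : ℤ) + p - 2 * l - j) / 2)
                      * invFact (((j : ℤ) + p - 2 * l - k) / 2)
                      * invFact (((j : ℤ) + k - p + 2 * l) / 2)
                      / (intPoch (a + 1) (((j : ℤ) + k + p - 2 * l) / 2)
                          * poch (2 * a + 2) j))) ∧
      ((j : ℤ) - k ∉ stepRange p →
        mulPowCoeff (planarGegenbauerSeq τ a hτ0 ha) p j k = 0)) := by
  exact ⟨fun p j k => ⟨mulPowCoeff_planarHermite τ hτ0 p j k,
      mulPowCoeff_planarHermite_eq_zero τ hτ0 p j k⟩,
    fun _ hν p j k => ⟨mulPowCoeff_planarLaguerre τ hν p j k,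
      mulPowCoeff_planarLaguerre_eq_zero τ hν p j k⟩,
    fun a ha p j k => ⟨mulPowCoeff_planarGegenbauer τ a hτ0 ha p j k,
      mulPowCoeff_planarGegenbauer_eq_zero τ a hτ0 ha p j k⟩⟩
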